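/- **List update with untrusted advice.** A list of $m$ items is to serve a sequence of requests to its items. An access to the item at position $i$ costs $i$; the accessed item may then be moved any distance towards the front for free, and at any time two consecutive items may be exchanged at cost $1$. $\textsc{Opt}(\sigma)$ is the least total cost of serving $\sigma$ offline from the same initial list. *Candidates.* MTFO (resp. MTFE) moves an item to the front on each of its odd-numbered (resp. even-numbered) requests. Timestamp inserts a requested item $x$ in front of the first item of the list that precedes $x$ and was requested at most once since the last request to $x$; if there is none, or if this is the first request to $x$, it does not move $x$. Mtf moves every requested item to the front. *The algorithm Tog* has a parameter $\beta\ge 0$. Its advice string (two bits suffice) names one of MTFO, MTFE and Timestamp. If it names Timestamp, Tog runs Timestamp. Otherwise, let Mtf2 be the algorithm named; Tog alternates between trusting and ignoring phases, beginning with a trusting one. At the beginning of a trusting phase Tog changes its list, by a least number of paid exchanges, to the list that Mtf2 would have at this point had it served the whole sequence so far; it then serves requests as Mtf2 does until the access cost of the phase is at least $m^3$. In an ignoring phase it serves requests by Mtf, starting from its current list, until the access cost of the phase is at least $\beta m^3$ (for $\beta=0$ ignoring phases are empty, and Tog is Mtf2). The advice is *right* (trusted) for $\sigma$ if the algorithm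 that it names has the least cost on $\sigma$ among the three candidates. Untrusted advice is arbitrary. *Competitiveness.* Say that Tog with parameter $\beta$ is $(r,w)$-competitive for long lists if for every $\varepsilon>0$ there is an $m_0$ such that for every $m\ge m_0$ there is a constant $K$ with the following property: for every initial list of length $m$ and every request sequence $\sigma$, the cost of Tog is at most $(r+\varepsilon)\,\textsc{Opt}(\sigma)+K$ with any right advice for $\sigma$, and at most $(w+\varepsilon)\,\textsc{Opt}(\sigma)+K$ with any advice. **Theorem.** For every $\beta\ge 0$, Tog with parameter $\beta$ is $\left(\frac53+\frac{5\beta}{6+3\beta},\ 2+\frac{2}{4+5\beta}\right)$-competitive for long lists. Consequently, for every $r\in[5/3,2]$ there is a $\beta\in[0,1/2]$ with $r=\frac53+\frac{5\beta}{6+3\beta}$, and Tog with this parameter is $(r,f(r))$-competitive for long lists, where $f(r)=2+\frac{10-3r}{9r-5}$. -/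

import Mathlib

namespace ListUpdate

section Model

variable {α : Type*}

/-- One paid exchange: two consecutive items of the list trade places (cost `1`). -/
def AdjSwap (L L' : List α) : Prop :=
  ∃ (A B : List α) (a b : α), L = A ++ a :: b :: B ∧ L' = A ++ b :: a :: B

/-- `Exchanges k L L'`: exactly `k` paid exchanges, one after the other, turn `L` into `L'`. -/
inductive Exchanges : ℕ → List α → List α → Prop
  | refl (L : List α) : Exchanges 0 L L
  | step {k : ℕ} {L L' L'' : List α} :
      AdjSwap L L' → Exchanges k L' L'' → Exchanges (k + 1) L L''

/-- The least number of paid exchanges that turn `L` into `L'` (used only for two orderings of the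
same items, where such a sequence of exchanges exists). -/
noncomputable def exchangeCost (L L' : List α) : ℕ :=
  sInf {k | Exchanges k L L'}

variable [DecidableEq α]

/-- The cost of an access to `x`: its position in the list, counted from `1`. -/
def accessCost (L : List α) (x : α) : ℕ := L.idxOf x + 1

/-- Take `x` out of the list and put it back at index `i` (counted from `0`). For
`i ≤ L.idxOf x` and `x` the item just accessed this is a free move towards the front. -/
def moveTo (L : List α) (x : α) (i : ℕ) : List α := (L.erase x).insertIdx i x

/-- `Serves L σ c`: starting from the list `L`, the request sequence `σ` can be served at total
cost `c`. At any time paid exchanges may be made at cost `1` each; each request pays its access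
cost, after which the accessed item may be moved any distance towards the front for free. -/
inductive Serves : List α → List α → ℕ → Prop
  | done (L : List α) : Serves L [] 0
  | paid {L L' σ : List α} {c : ℕ} : AdjSwap L L' → Serves L' σ c → Serves L σ (c + 1)
  | access {L σ : List α} {x : α} {i c : ℕ} :
      i ≤ L.idxOf x → Serves (moveTo L x i) σ c → Serves L (x :: σ) (accessCost L x + c)

/-- The optimal offline cost of serving `σ` from the initial list `L`. -/
noncomputable def opt (L σ : List α) : ℕ := sInf {c | Serves L σ c}

/-- An online rule that makes free exchanges only: from the past requests (most recent first), the
current list and the item just accessed, it computes the index (counted from `0`) to which this item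
is moved. -/
abbrev Rule (α : Type*) := List α → List α → α → ℕ

/-- The cost of a rule on the remaining requests, when `h` are the past requests (most recent first)
and `L` is the current list. -/
def ruleCost (R : Rule α) : List α → List α → List α → ℕ
  | _, _, [] => 0
  | h, L, x :: σ => accessCost L x + ruleCost R (x :: h) (moveTo L x (R h L x)) σ

/-- Move-To-Front. -/
def mtf : Rule α := fun _ _ _ => 0

/-- `MTFO`: an item is moved to the front on its first, third, fifth, ... request. -/
def mtfo : Rule α := fun h L x => if Even (h.count x) then 0 else L.idxOf x

/-- `MTFE`: an item is moved to the front on its second, fourth, sixth, ... request. -/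
def mtfe : Rule α := fun h L x => if Odd (h.count x) then 0 else L.idxOf x

/-- `Timestamp`: on a request to `x`, insert `x` in front of the first item of the list that precedes
`x` and was requested at most once since the last request to `x`. If there is no such item, or if `x`
is requested for the first time, do not move `x`. (The item `x` itself passes the test in `findIdx`,
so the index found is at most that of `x`, with equality if no preceding item passes.) -/
def timestamp : Rule α := fun h L x =>
  if x ∈ h then L.findIdx (fun y => decide ((h.takeWhile (fun z => decide (z ≠ x))).count y ≤ 1))
  else L.idxOf x

end Model

/-- The three algorithms that the advice can name. -/
inductive Candidate
  | timestamp
  | mtfo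
  | mtfe

/-- The rule of a candidate algorithm. -/
def Candidate.rule {α : Type*} [DecidableEq α] : Candidate → Rule α
  | .timestamp => ListUpdate.timestamp
  | .mtfo => ListUpdate.mtfo
  | .mtfe => ListUpdate.mtfe

/-- The candidate algorithm that an advice string names; only the first two bits matter. -/
def decode : List Bool → Candidate
  | true :: false :: _ => .mtfo
  | true :: true :: _ => .mtfe
  | _ => .timestamp

section Toggle

variable {α : Type*}

/-- What the phased algorithm remembers: the past requests (most recent first), the list that the
indicated algorithm `MTF2` would have at this point had it served all requests so far, its own list,
the type of the current phase, and the access cost it has paid in the current phase. -/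
structure TogState (α : Type*) where
  history : List α
  simulated : List α
  current : List α
  trusting : Bool
  phaseCost : ℕ

/-- A trusting phase is over once its access cost is at least `m ^ 3`; an ignoring phase follows. -/
def TogState.endTrusting (m : ℕ) (s : TogState α) : TogState α :=
  if s.trusting = true ∧ m ^ 3 ≤ s.phaseCost then
    { s with trusting := false, phaseCost := 0 }
  else s

/-- An ignoring phase is over once its access cost is at least `β * m ^ 3`. -/
def TogState.IgnoringOver (m : ℕ) (β : ℝ) (s : TogState α) : Prop :=
  s.trusting = false ∧ β * (m : ℝ) ^ 3 ≤ (s.phaseCost : ℝ)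

open Classical in
/-- After an ignoring phase a trusting phase follows. At its beginning the list is changed, by paid
exchanges, to the one that `MTF2` would have. -/
noncomputable def TogState.endIgnoring (m : ℕ) (β : ℝ) (s : TogState α) : TogState α :=
  if s.IgnoringOver m β then
    { s with current := s.simulated, trusting := true, phaseCost := 0 }
  else s

open Classical in
/-- The cost of the paid exchanges made by `TogState.endIgnoring`. -/
noncomputable def TogState.paidCost (m : ℕ) (β : ℝ) (s : TogState α) : ℕ :=
  if s.IgnoringOver m β then exchangeCost s.current s.simulated else 0

variable [DecidableEq α]

/-- Serve a request to `x`: as `MTF2` (given by its rule `R`) in a trusting phase, by Move-To-Front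
in an ignoring phase. -/
def TogState.serve (R : Rule α) (s : TogState α) (x : α) : TogState α where
  history := x :: s.history
  simulated := moveTo s.simulated x (R s.history s.simulated x)
  current := moveTo s.current x
    (if s.trusting = true then R s.history s.current x else mtf s.history s.current x)
  trusting := s.trusting
  phaseCost := s.phaseCost + accessCost s.current x

/-- The cost of toggling between the rule `R` and Move-To-Front on the remaining requests, from the
state `s`. Phases that are over are closed when the next request arrives. -/
noncomputable def toggleCost (m : ℕ) (β : ℝ) (R : Rule α) : TogState α → List α → ℕ
  | _, [] => 0
  | s, x :: σ =>
      let s₁ := s.endTrusting m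
      let s₂ := s₁.endIgnoring m β
      s₁.paidCost m β + accessCost s₂.current x + toggleCost m β R (s₂.serve R x) σ

/-- The cost of `Tog` with parameter `β` and advice `φ` on the request sequence `σ`, from the initial
list `L`, whose length is `m`. If the advice names Timestamp, then Timestamp serves all requests;
otherwise `Tog` toggles, starting with a trusting phase. -/
noncomputable def togCost (m : ℕ) (β : ℝ) (L : List α) (φ : List Bool) (σ : List α) : ℕ :=
  match decode φ with
  | .timestamp => ruleCost timestamp [] L σ
  | .mtfo => toggleCost m β mtfo ⟨[], L, L, true, 0⟩ σ
  | .mtfe => toggleCost m β mtfe ⟨[], L, L, true, 0⟩ σ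

/-- The advice `φ` is right: it names a candidate whose cost on `σ` is least among the three. -/
def Trusted (L : List α) (φ : List Bool) (σ : List α) : Prop :=
  ∀ A : Candidate, ruleCost (decode φ).rule [] L σ ≤ ruleCost A.rule [] L σ

/-- For every request sequence there is right advice (of two bits). -/
theorem exists_trusted (L σ : List α) : ∃ φ : List Bool, φ.length = 2 ∧ Trusted L φ σ := by
  have key : ∃ A : Candidate, ∀ B : Candidate,
      ruleCost A.rule [] L σ ≤ ruleCost B.rule [] L σ := by
    have : Nonempty Candidate := ⟨.mtfo⟩
    exact ⟨Function.argmin (fun A : Candidate => ruleCost A.rule [] L σ), fun B =>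
      Function.argmin_le (fun A : Candidate => ruleCost A.rule [] L σ) B⟩
  obtain ⟨A, hA⟩ := key
  cases A
  · exact ⟨[false, false], rfl, hA⟩
  · exact ⟨[true, false], rfl, hA⟩
  · exact ⟨[true, true], rfl, hA⟩

end Toggle

/-- On lists of length `m`, `Tog` with parameter `β` has (asymptotic) competitive ratio at most `r`
with trusted advice and at most `w` with untrusted (adversarial) advice: the cost is at most the ratio
times the optimal offline cost, plus a constant that does not depend on the request sequence, for
every ordering `L` of the `m` items as initial list. -/
def TogCompetitiveOn (m : ℕ) (β r w : ℝ) : Prop :=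
  ∃ K : ℝ, ∀ L : List (Fin m), L.Perm (List.finRange m) → ∀ σ : List (Fin m),
    (∀ φ : List Bool, Trusted L φ σ →
      (togCost m β L φ σ : ℝ) ≤ r * (opt L σ : ℝ) + K) ∧
    (∀ φ : List Bool, (togCost m β L φ σ : ℝ) ≤ w * (opt L σ : ℝ) + K)

/-- `Tog` with parameter `β` is `(r, w)`-competitive for long lists: as the length of the list grows,
its two competitive ratios converge to values of at most `r` and `w`. -/
def TogCompetitive (β r w : ℝ) : Prop :=
  ∀ ε : ℝ, 0 < ε → ∃ m₀ : ℕ, ∀ m : ℕ, m₀ ≤ m → TogCompetitiveOn m β (r + ε) (w + ε)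

end ListUpdate

/-!
The index of an item is the number of items in front of it, so every access cost is a sum over
pairs of items, and so are the potentials: they depend on the state of the algorithm on each pair
and on the order of the pair in the adversary's list. A paid exchange of the adversary affects one
pair, and for every other pair finitely many cases remain to be checked. For Move-To-Front, whose
potential is the number of inversions, this gives a factor `2`. For MTFO and MTFE the potential
also records the parities, and the factor is `5 / 2`. The orders of a pair in the lists of MTFO,
MTFE and Timestamp are all determined by the interleaving of the last two requests to either item
and the parities; this yields a joint potential by which the three costs add up to at most
`5 * opt`, so that the cheapest candidate loses only a factor `5 / 3`, and one for Timestamp alone,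
with factor `2`.

All these potentials are `O(m ^ 2)`, as is the cost of a change of lists, which is negligible
against the cost `m ^ 3` of a trusting phase. If the rule named by the advice costs at most `κ`
times as much as an adversary, the adversary pays at least `m ^ 3 / κ` in a trusting phase and
`β * m ^ 3 / 2` in an ignoring one, up to lower order terms, so Tog is competitive with ratio
`(1 + β) / (1 / κ + β / 2)` against it. With `κ = 5 / 2` and an optimal adversary, this is the
bound for arbitrary advice. For right advice, take as adversary the rule itself: then `κ = 1`, and
its cost is at most `5 / 3 * opt`.
-/

namespace ListUpdate

section Order

variable {α : Type*}

/-- `L` is an ordering of all items of the type `α`, each of them occurring exactly once. -/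
structure IsListing (L : List α) : Prop where
  nodup : L.Nodup
  complete : ∀ x, x ∈ L

theorem IsListing.perm {L L' : List α} (h : IsListing L) (hp : L.Perm L') : IsListing L' :=
  ⟨hp.nodup_iff.1 h.nodup, fun x => hp.mem_iff.1 (h.complete x)⟩

theorem IsListing.length_eq_card [Fintype α] {L : List α} (h : IsListing L) :
    L.length = Fintype.card α := by
  classical
  rw [← List.toFinset_card_of_nodup h.nodup, ← Finset.card_univ]
  congr 1
  ext x
  simp [h.complete x]

variable [DecidableEq α]

/-- The order of two items in a list: `x` precedes `y` in `L`. -/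
def before (L : List α) (x y : α) : Bool := decide (L.idxOf x < L.idxOf y)

theorem before_eq_of_sublist {K L : List α} (h : K.Sublist L) (hL : L.Nodup) {x y : α}
    (hx : x ∈ K) (hy : y ∈ K) : before K x y = before L x y := by
  rw [before, before, decide_eq_decide]
  induction h with
  | slnil => simp at hx
  | @cons K L a hKL ih =>
    obtain ⟨haL, hL⟩ := List.nodup_cons.1 hL
    have hne : ∀ z ∈ K, a ≠ z := fun z hz e => haL (e ▸ hKL.subset hz)
    rw [ih hL hx hy, List.idxOf_cons_ne _ (hne x hx), List.idxOf_cons_ne _ (hne y hy)]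
    simp
  | @cons_cons K L a _ ih =>
    have hL := (List.nodup_cons.1 hL).2
    rcases eq_or_ne a x with rfl | hax <;> rcases eq_or_ne a y with rfl | hay
    · simp
    · simp [List.idxOf_cons_ne _ hay]
    · simp
    · rw [List.idxOf_cons_ne _ hax, List.idxOf_cons_ne _ hay, List.idxOf_cons_ne _ hax,
        List.idxOf_cons_ne _ hay, Nat.succ_lt_succ_iff, Nat.succ_lt_succ_iff]
      exact ih hL (List.mem_of_ne_of_mem hax.symm hx) (List.mem_of_ne_of_mem hay.symm hy)

theorem IsListing.idxOf_lt {L : List α} (h : IsListing L) (x : α) : L.idxOf x < L.length :=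
  List.idxOf_lt_length_of_mem (h.complete x)

theorem IsListing.idxOf_injective {L : List α} (h : IsListing L) :
    Function.Injective fun x => L.idxOf x :=
  fun x _ => (List.idxOf_inj (h.complete x)).1

theorem IsListing.before_swap {L : List α} (h : IsListing L) {x y : α} (hxy : x ≠ y) :
    before L y x = !before L x y := by
  have hne : L.idxOf x ≠ L.idxOf y := h.idxOf_injective.ne hxy
  rw [before, before, ← decide_not, decide_eq_decide]
  omega

theorem IsListing.accessCost_le_card [Fintype α] {L : List α} (h : IsListing L) (x : α) :
    accessCost L x ≤ Fintype.card α :=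
  (h.idxOf_lt x).trans_eq h.length_eq_card

theorem IsListing.idxOf_eq_sum [Fintype α] {L : List α} (h : IsListing L) (x : α) :
    L.idxOf x = ∑ y ∈ Finset.univ.erase x, (before L y x).toNat := by
  have image_filter : (Finset.univ.filter fun y => L.idxOf y < L.idxOf x).image (L.idxOf ·)
      = Finset.range (L.idxOf x) := by
    ext k
    simp only [Finset.mem_image, Finset.mem_filter, Finset.mem_univ, true_and, Finset.mem_range]
    refine ⟨?_, fun hk => ?_⟩
    · rintro ⟨y, hy, rfl⟩
      exact hy
    · have hidx := h.nodup.idxOf_getElem k (hk.trans (h.idxOf_lt x))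
      exact ⟨_, hidx.trans_lt hk, hidx⟩
  calc L.idxOf x = (Finset.univ.filter fun y => L.idxOf y < L.idxOf x).card := by
        rw [← Finset.card_image_of_injective _ h.idxOf_injective, image_filter, Finset.card_range]
    _ = ∑ y, (before L y x).toNat := by
        rw [Finset.card_filter]
        exact Finset.sum_congr rfl fun y _ => by
          by_cases hy : L.idxOf y < L.idxOf x <;> simp [before, hy]
    _ = ∑ y ∈ Finset.univ.erase x, (before L y x).toNat :=
        (Finset.sum_erase Finset.univ (by simp [before])).symm

section MoveTo

variable {L : List α} {x : α} {i : ℕ}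

theorem IsListing.le_length_erase (h : IsListing L) (hi : i ≤ L.idxOf x) :
    i ≤ (L.erase x).length := by
  have := h.idxOf_lt x
  rw [List.length_erase_of_mem (h.complete x)]
  omega

theorem IsListing.moveTo (h : IsListing L) (hi : i ≤ L.idxOf x) : IsListing (moveTo L x i) :=
  h.perm ((List.perm_cons_erase (h.complete x)).trans
    (List.perm_insertIdx x _ (h.le_length_erase hi)).symm)

theorem before_moveTo_of_ne (h : IsListing L) (hi : i ≤ L.idxOf x) {y z : α} (hy : y ≠ x)
    (hz : z ≠ x) : before (moveTo L x i) y z = before L y z := by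
  have mem_erase : ∀ w, w ≠ x → w ∈ L.erase x := fun w hw =>
    (List.mem_erase_of_ne hw).2 (h.complete w)
  exact (before_eq_of_sublist (List.sublist_insertIdx _ i x) (h.moveTo hi).nodup (mem_erase y hy)
    (mem_erase z hz)).symm.trans
      (before_eq_of_sublist List.erase_sublist h.nodup (mem_erase y hy) (mem_erase z hz))

theorem idxOf_moveTo_self (h : IsListing L) (hi : i ≤ L.idxOf x) :
    (moveTo L x i).idxOf x = i := by
  have hlt : i < (moveTo L x i).length := by
    rw [moveTo, List.length_insertIdx_of_le_length (h.le_length_erase hi)]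
    exact Nat.lt_succ_of_le (h.le_length_erase hi)
  have hget : (moveTo L x i)[i] = x := List.getElem_insertIdx_self hlt
  simpa only [hget] using (h.moveTo hi).nodup.idxOf_getElem i hlt

theorem before_moveTo_right (h : IsListing L) (hi : i ≤ L.idxOf x) (y : α) :
    before (moveTo L x i) y x = decide (L.idxOf y < i) := by
  rw [before, idxOf_moveTo_self h hi, decide_eq_decide,
    ← List.mem_take_iff_idxOf_lt ((h.moveTo hi).complete y),
    ← List.mem_take_iff_idxOf_lt (h.complete y), moveTo,
    List.take_insertIdx_eq_take_of_le _ _ _ _ le_rfl, ← List.eraseIdx_idxOf_eq_erase,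
    List.take_eraseIdx_eq_take_of_le _ _ _ hi]

theorem before_moveTo_left (h : IsListing L) (hi : i ≤ L.idxOf x) {y : α} (hy : y ≠ x) :
    before (moveTo L x i) x y = decide (i ≤ L.idxOf y) := by
  rw [(h.moveTo hi).before_swap hy, before_moveTo_right h hi, ← decide_not, decide_eq_decide,
    not_lt]

end MoveTo

end Order

section Exchanges

variable {α : Type*}

theorem AdjSwap.perm {L L' : List α} (h : AdjSwap L L') : L.Perm L' := by
  obtain ⟨A, B, a, b, rfl, rfl⟩ := h
  exact List.Perm.append_left A (List.Perm.swap b a B)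

theorem AdjSwap.exists_before_eq [DecidableEq α] {L L' : List α} (hL : IsListing L)
    (h : AdjSwap L L') : ∃ a b, a ≠ b ∧ ∀ x y, (x ≠ a ∧ y ≠ a ∨ x ≠ b ∧ y ≠ b) →
      before L' x y = before L x y := by
  have hL' := hL.perm h.perm
  obtain ⟨A, B, a, b, rfl, rfl⟩ := h
  have before_eq : ∀ {K : List α} {x y : α}, K.Sublist (A ++ a :: b :: B) →
      K.Sublist (A ++ b :: a :: B) → x ∈ K → y ∈ K →
      before (A ++ b :: a :: B) x y = before (A ++ a :: b :: B) x y := fun h h' hx hy =>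
    (before_eq_of_sublist h' hL'.nodup hx hy).symm.trans (before_eq_of_sublist h hL.nodup hx hy)
  refine ⟨a, b, ?_, fun x y hxy => ?_⟩
  · rintro rfl
    simpa using (List.nodup_append.1 hL.nodup).2.1
  · have hx := hL.complete x
    have hy := hL.complete y
    simp only [List.mem_append, List.mem_cons] at hx hy
    rcases hxy with ⟨hxa, hya⟩ | ⟨hxb, hyb⟩
    · exact before_eq (K := A ++ b :: B) (by simp) (by simp) (by simp; tauto) (by simp; tauto)
    · exact before_eq (K := A ++ a :: B) (by simp) (by simp) (by simp; tauto) (by simp; tauto)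

theorem Exchanges.perm {k : ℕ} {L L' : List α} (h : Exchanges k L L') : L.Perm L' := by
  induction h with
  | refl L => exact List.Perm.refl L
  | step hs _ ih => exact hs.perm.trans ih

theorem Exchanges.trans {j k : ℕ} {L L' L'' : List α} (h : Exchanges j L L')
    (h' : Exchanges k L' L'') : Exchanges (j + k) L L'' := by
  induction h with
  | refl L => rwa [Nat.zero_add]
  | step hs _ ih =>
    rw [Nat.add_right_comm]
    exact .step hs (ih h')

theorem Exchanges.cons {k : ℕ} {L L' : List α} (a : α) (h : Exchanges k L L') :
    Exchanges k (a :: L) (a :: L') := by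
  induction h with
  | refl L => exact .refl _
  | step hs _ ih =>
    obtain ⟨A, B, x, y, rfl, rfl⟩ := hs
    exact .step ⟨a :: A, B, x, y, rfl, rfl⟩ ih

theorem exchanges_append_cons (A B : List α) (a : α) :
    Exchanges A.length (A ++ a :: B) (a :: (A ++ B)) := by
  induction A with
  | nil => exact .refl _
  | cons c A ih => exact (ih.cons c).trans (.step ⟨[], A ++ B, c, a, rfl, rfl⟩ (.refl _))

theorem exists_exchanges_le {L L' : List α} (h : L.Perm L') :
    ∃ k ≤ L.length ^ 2, Exchanges k L L' := by
  induction L' generalizing L with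
  | nil => exact ⟨0, Nat.zero_le _, h.eq_nil ▸ .refl _⟩
  | cons a T ih =>
    obtain ⟨A, B, rfl⟩ := List.append_of_mem (h.mem_iff.2 List.mem_cons_self)
    obtain ⟨k, hk, hex⟩ := ih (List.perm_middle.symm.trans h).cons_inv
    refine ⟨A.length + k, ?_, (exchanges_append_cons A B a).trans (hex.cons a)⟩
    simp only [List.length_append, List.length_cons] at hk ⊢
    linarith [sq_nonneg (A.length + B.length), Nat.zero_le A.length,
      show (A.length + (B.length + 1)) ^ 2
        = (A.length + B.length) ^ 2 + 2 * A.length + 2 * B.length + 1 by ring]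

theorem exchangeCost_le {L L' : List α} (h : L.Perm L') : exchangeCost L L' ≤ L.length ^ 2 := by
  obtain ⟨k, hk, hex⟩ := exists_exchanges_le h
  exact (Nat.sInf_le hex).trans hk

end Exchanges

section Service

variable {α : Type*}

/-- The total over the requests of `σ`, following the requests `h`, of a cost of single requests
that depends on the requests before them (most recent first). -/
def totalCost (cost : List α → α → ℕ) : List α → List α → ℕ
  | _, [] => 0
  | h, x :: σ => cost h x + totalCost cost (x :: h) σ

theorem totalCost_add (cost cost' : List α → α → ℕ) (h σ : List α) :
    totalCost (fun h x => cost h x + cost' h x) h σ = totalCost cost h σ + totalCost cost' h σ := by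
  induction σ generalizing h with
  | nil => rfl
  | cons x σ ih =>
    simp only [totalCost, ih]
    omega

variable [DecidableEq α]

/-- One request of an arbitrary way of serving: from the list `L`, the request to `x` is served at
total cost `c`, which includes the paid exchanges made before the access, and leaves the list
`L'`. -/
def ServeStep (L : List α) (x : α) (c : ℕ) (L' : List α) : Prop :=
  ∃ k M i, Exchanges k L M ∧ i ≤ M.idxOf x ∧ c = k + accessCost M x ∧ L' = moveTo M x i

theorem ServeStep.isListing {L L' : List α} {x : α} {c : ℕ} (h : ServeStep L x c L')
    (hL : IsListing L) : IsListing L' := by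
  obtain ⟨k, M, i, hex, hi, -, rfl⟩ := h
  exact (hL.perm hex.perm).moveTo hi

theorem Serves.exists_serveStep {L σ : List α} {x : α} {c : ℕ} (h : Serves L (x :: σ) c) :
    ∃ c₀ c₁ L', ServeStep L x c₀ L' ∧ Serves L' σ c₁ ∧ c = c₀ + c₁ := by
  generalize hτ : x :: σ = τ at h
  induction h with
  | done L => cases hτ
  | paid hs _ ih =>
    obtain ⟨_, c₁, L', ⟨k, M, i, hex, hi, rfl, hL'⟩, hserves, rfl⟩ := ih hτ
    exact ⟨_, c₁, L', ⟨k + 1, M, i, .step hs hex, hi, rfl, hL'⟩, hserves, by ring⟩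
  | @access L σ x i c hi hserves =>
    obtain ⟨rfl, rfl⟩ := List.cons.inj hτ
    exact ⟨_, c, _, ⟨0, L, i, .refl L, hi, rfl, rfl⟩, hserves, by ring⟩

/-- A rule whose moves are free: it never moves the accessed item backwards. -/
def Rule.IsForward (R : Rule α) : Prop := ∀ h L x, R h L x ≤ L.idxOf x

theorem isForward_mtf : (mtf : Rule α).IsForward := fun _ _ _ => Nat.zero_le _

theorem Rule.IsForward.serveStep {R : Rule α} (hR : R.IsForward) (h L : List α) (x : α) :
    ServeStep L x (accessCost L x) (moveTo L x (R h L x)) :=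
  ⟨0, L, R h L x, .refl L, hR h L x, (Nat.zero_add _).symm, rfl⟩

theorem Rule.IsForward.serves_ruleCost {R : Rule α} (hR : R.IsForward) (h L σ : List α) :
    Serves L σ (ruleCost R h L σ) := by
  induction σ generalizing h L with
  | nil => exact .done L
  | cons x σ ih => exact .access (hR h L x) (ih _ _)

theorem serves_opt (L σ : List α) : Serves L σ (opt L σ) :=
  Nat.sInf_mem (s := {c | Serves L σ c}) ⟨_, isForward_mtf.serves_ruleCost [] L σ⟩

/-- The list of the rule `R` after the requests `h` (most recent first), starting from `L₀`. -/
def listAfter (R : Rule α) (L₀ : List α) : List α → List α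
  | [] => L₀
  | x :: h => moveTo (listAfter R L₀ h) x (R h (listAfter R L₀ h) x)

theorem IsListing.listAfter {R : Rule α} (hR : R.IsForward) {L₀ : List α} (hL₀ : IsListing L₀)
    (h : List α) : IsListing (listAfter R L₀ h) := by
  induction h with
  | nil => exact hL₀
  | cons x h ih => exact ih.moveTo (hR _ _ _)

/-- The cost at which the rule `R`, started from `L₀`, serves `x` after the requests `h`. -/
def costAfter (R : Rule α) (L₀ h : List α) (x : α) : ℕ := accessCost (listAfter R L₀ h) x

theorem ruleCost_listAfter (R : Rule α) (L₀ h σ : List α) :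
    ruleCost R h (listAfter R L₀ h) σ = totalCost (costAfter R L₀) h σ := by
  induction σ generalizing h with
  | nil => rfl
  | cons x σ ih => exact congrArg (costAfter R L₀ h x + ·) (ih (x :: h))

end Service

section PairPotential

variable {α : Type*} [Fintype α] [DecidableEq α]

/-- The potential of a list `L` that is made up of contributions `G x y o` of the ordered pairs of
distinct items, where `o` tells whether `x` precedes `y` in `L`. -/
def pairSum (G : α → α → Bool → ℕ) (L : List α) : ℕ :=
  ∑ p ∈ Finset.univ.offDiag, G p.1 p.2 (before L p.1 p.2)

theorem sum_offDiag_eq (F : α → α → ℕ) (x : α) :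
    ∑ p ∈ Finset.univ.offDiag, F p.1 p.2 =
      ∑ p ∈ (Finset.univ.erase x).offDiag, F p.1 p.2
        + ∑ y ∈ Finset.univ.erase x, (F x y + F y x) := by
  have hx : x ∉ Finset.univ.erase x := Finset.notMem_erase x _
  conv_lhs => rw [← Finset.insert_erase (Finset.mem_univ x)]
  rw [Finset.offDiag_insert hx, Finset.sum_union, Finset.sum_union, Finset.singleton_product,
    Finset.product_singleton, Finset.sum_map, Finset.sum_map, Finset.sum_add_distrib, add_assoc]
  · rfl
  all_goals
    rw [Finset.disjoint_left]
    rintro ⟨a, b⟩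
    simp only [Finset.mem_union, Finset.mem_product, Finset.mem_offDiag, Finset.mem_singleton]
    rintro h h'
    grind

section Bounded

variable {G : α → α → Bool → ℕ} {c : ℕ} (hG : ∀ x y o, x ≠ y → G x y o ≤ c)
include hG

theorem pairSum_le (L : List α) : pairSum G L ≤ c * Fintype.card α ^ 2 := by
  calc pairSum G L ≤ (Finset.univ : Finset α).offDiag.card • c :=
        Finset.sum_le_card_nsmul _ _ c fun p hp => hG _ _ _ (Finset.mem_offDiag.1 hp).2.2
    _ ≤ c * Fintype.card α ^ 2 := by
        rw [Finset.offDiag_card, smul_eq_mul, mul_comm, Finset.card_univ, pow_two]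
        exact Nat.mul_le_mul_left _ (Nat.sub_le _ _)

theorem pairSum_adjSwap {L L' : List α} (hL : IsListing L) (h : AdjSwap L L') :
    pairSum G L' ≤ pairSum G L + 2 * c := by
  obtain ⟨a, b, hab, hbefore⟩ := h.exists_before_eq hL
  let S : Finset (α × α) := {(a, b), (b, a)}
  calc pairSum G L'
      ≤ ∑ p ∈ Finset.univ.offDiag,
          (G p.1 p.2 (before L p.1 p.2) + if p ∈ S then c else 0) := by
        refine Finset.sum_le_sum fun p hp => ?_
        have hp' : p.1 ≠ p.2 := (Finset.mem_offDiag.1 hp).2.2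
        split_ifs with hS
        · exact (hG _ _ _ hp').trans (Nat.le_add_left _ _)
        · rw [hbefore _ _ (by simp only [S, Finset.mem_insert, Finset.mem_singleton,
            Prod.ext_iff] at hS; grind), add_zero]
    _ = pairSum G L + (Finset.univ.offDiag.filter (· ∈ S)).card * c := by
        rw [Finset.sum_add_distrib, ← Finset.sum_filter, Finset.sum_const, smul_eq_mul, pairSum]
    _ ≤ pairSum G L + 2 * c := by
        gcongr
        exact (Finset.card_le_card fun p hp => (Finset.mem_filter.1 hp).2).trans Finset.card_le_two

theorem pairSum_exchanges {k : ℕ} {L L' : List α} (hL : IsListing L) (h : Exchanges k L L') :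
    pairSum G L' ≤ pairSum G L + 2 * c * k := by
  induction h with
  | refl L => exact Nat.le_add_right _ _
  | step hs _ ih => linarith [ih (hL.perm hs.perm), pairSum_adjSwap hG hL hs]

end Bounded

/-- The potential `pairSum G L` on the scale of a single cost, when costs multiplied by `d` are
accounted for by `G`. The other factor `2` is there because every unordered pair occurs twice in
`pairSum`. -/
noncomputable def pairPotential (d : ℕ) (G : α → α → Bool → ℕ) (L : List α) : ℝ :=
  pairSum G L / (2 * d)

theorem pairPotential_nonneg (d : ℕ) (G : α → α → Bool → ℕ) (L : List α) :
    0 ≤ pairPotential d G L := by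
  unfold pairPotential
  positivity

theorem pairPotential_le (d : ℕ) {G : α → α → Bool → ℕ} {c : ℕ}
    (hG : ∀ x y o, x ≠ y → G x y o ≤ c) (L : List α) :
    pairPotential d G L ≤ c / (2 * d) * (Fintype.card α : ℝ) ^ 2 := by
  have hsum : (pairSum G L : ℝ) ≤ c * (Fintype.card α : ℝ) ^ 2 := mod_cast pairSum_le hG L
  rw [pairPotential, div_mul_eq_mul_div]
  gcongr

/-- How a pair potential changes from `G` to `G'` by a request to `x` when the adversary may only
move `x` forwards: a pair of `x` and `y` pays for the charge `A y`, helped by `c` if `y` precedes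
`x` in the list of the adversary. The contributions are at most `c`, which is what one paid
exchange buys. -/
structure PairStep (c : ℕ) (x : α) (A : α → ℕ) (G G' : α → α → Bool → ℕ) : Prop where
  le : ∀ y z o, y ≠ z → G y z o ≤ c
  other : ∀ y z o, y ≠ x → z ≠ x → y ≠ z → G' y z o ≤ G y z o
  fst : ∀ y, y ≠ x → ∀ o o' : Bool, (o → o') → G' x y o' + A y ≤ G x y o + c * (!o).toNat
  snd : ∀ y, y ≠ x → ∀ o o' : Bool, (o' → o) → G' y x o' + A y ≤ G y x o + c * o.toNat

namespace PairStep

variable {c : ℕ} {x : α} {A : α → ℕ} {G G' : α → α → Bool → ℕ}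

theorem pairSum_moveTo_le (hG : PairStep c x A G G') {L : List α} (hL : IsListing L) {i : ℕ}
    (hi : i ≤ L.idxOf x) :
    pairSum G' (moveTo L x i) + 2 * ∑ y ∈ Finset.univ.erase x, A y ≤
      pairSum G L + 2 * c * L.idxOf x := by
  rw [pairSum, pairSum, sum_offDiag_eq (fun y z => G' y z (before (moveTo L x i) y z)) x,
    sum_offDiag_eq (fun y z => G y z (before L y z)) x, hL.idxOf_eq_sum x, mul_assoc 2 c,
    add_assoc, add_assoc, Finset.mul_sum, Finset.mul_sum, Finset.mul_sum,
    ← Finset.sum_add_distrib, ← Finset.sum_add_distrib]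
  refine Nat.add_le_add (Finset.sum_le_sum fun p hp => ?_) (Finset.sum_le_sum fun y hy => ?_)
  · simp only [Finset.mem_offDiag, Finset.mem_erase, Finset.mem_univ, and_true] at hp
    rw [before_moveTo_of_ne hL hi hp.1 hp.2.1]
    exact hG.other _ _ _ hp.1 hp.2.1 hp.2.2
  · have hyx : y ≠ x := Finset.ne_of_mem_erase hy
    have fst := hG.fst y hyx (before L x y) (before (moveTo L x i) x y) (by
      rw [before_moveTo_left hL hi hyx]
      simp only [before, decide_eq_true_eq]
      omega)
    have snd := hG.snd y hyx (before L y x) (before (moveTo L x i) y x) (by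
      rw [before_moveTo_right hL hi]
      simp only [before, decide_eq_true_eq]
      omega)
    rw [hL.before_swap hyx, Bool.not_not] at fst
    rw [hL.before_swap hyx]
    linarith

theorem pairSum_serveStep_le (hG : PairStep c x A G G') {L L' : List α} (hL : IsListing L)
    {k : ℕ} (h : ServeStep L x k L') :
    pairSum G' L' + 2 * (∑ y ∈ Finset.univ.erase x, A y + c) ≤ pairSum G L + 2 * c * k := by
  obtain ⟨j, M, i, hex, hi, rfl, rfl⟩ := h
  have hmove := hG.pairSum_moveTo_le (hL.perm hex.perm) hi
  have hexch := pairSum_exchanges hG.le hL hex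
  rw [accessCost]
  linarith

theorem pairPotential_serveStep_le (hG : PairStep c x A G G') {d cost : ℕ} (hd : 0 < d)
    (hcost : d * cost ≤ ∑ y ∈ Finset.univ.erase x, A y + c) {L L' : List α} (hL : IsListing L)
    {k : ℕ} (h : ServeStep L x k L') :
    cost + pairPotential d G' L' ≤ c / d * k + pairPotential d G L := by
  have hnat : pairSum G' L' + 2 * (d * cost) ≤ pairSum G L + 2 * c * k :=
    (Nat.add_le_add_left (Nat.mul_le_mul_left 2 hcost) _).trans (hG.pairSum_serveStep_le hL h)
  have hreal : (pairSum G' L' + 2 * (d * cost) : ℝ) ≤ pairSum G L + 2 * c * k := mod_cast hnat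
  have hd' : (0 : ℝ) < d := mod_cast hd
  rw [pairPotential, pairPotential, ← mul_le_mul_iff_right₀ (show (0 : ℝ) < 2 * d by positivity)]
  field_simp
  linarith

end PairStep

end PairPotential

section AmortizedRun

variable {α : Type*} [DecidableEq α]

/-- A run of the adversary that serves the requests `σ`, following the requests `h`, from the list
`L` at total cost `c`, against which the costs of an algorithm are amortized request by request:
up to the change of the potential `Φ`, which is read from the past requests and the list of the
adversary, each of them is at most `κ` times the cost of the adversary. -/
inductive AmortizedRun (κ : ℝ) (cost : List α → α → ℕ) (Φ : List α → List α → ℝ) :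
    List α → List α → List α → ℕ → Prop
  | done (h L : List α) (c : ℕ) : AmortizedRun κ cost Φ h L [] c
  | request {h L L' σ : List α} {x : α} {c c' : ℕ} (hstep : ServeStep L x c L')
      (hcost : cost h x + Φ (x :: h) L' ≤ κ * c + Φ h L)
      (hrun : AmortizedRun κ cost Φ (x :: h) L' σ c') :
      AmortizedRun κ cost Φ h L (x :: σ) (c + c')

theorem AmortizedRun.totalCost_le {κ : ℝ} {cost : List α → α → ℕ} {Φ : List α → List α → ℝ}
    {h L σ : List α} {c : ℕ} (hrun : AmortizedRun κ cost Φ h L σ c) (hκ : 0 ≤ κ)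
    (hΦ : ∀ h L, 0 ≤ Φ h L) :
    totalCost cost h σ ≤ κ * c + Φ h L := by
  induction hrun with
  | done h L c =>
    rw [totalCost, Nat.cast_zero]
    exact add_nonneg (mul_nonneg hκ c.cast_nonneg) (hΦ h L)
  | request _ hcost _ ih =>
    rw [totalCost]
    push_cast
    linarith

theorem amortizedRun_self {R : Rule α} (hR : R.IsForward) (L₀ h σ : List α) :
    AmortizedRun 1 (costAfter R L₀) 0 h (listAfter R L₀ h) σ
      (ruleCost R h (listAfter R L₀ h) σ) := by
  induction σ generalizing h with
  | nil => exact .done _ _ 0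
  | cons x σ ih => exact .request (hR.serveStep h _ x) (by simp [costAfter]) (ih (x :: h))

theorem Serves.amortizedRun [Fintype α] {c d : ℕ} (hd : 0 < d) {cost : List α → α → ℕ}
    {A : List α → α → α → ℕ} {G : List α → α → α → Bool → ℕ}
    (hG : ∀ h x, PairStep c x (A h x) (G h) (G (x :: h)))
    (hcost : ∀ h x, d * cost h x ≤ ∑ y ∈ Finset.univ.erase x, A h x y + c)
    {L σ : List α} {k : ℕ} (hserves : Serves L σ k) (hL : IsListing L) (h : List α) :
    AmortizedRun (c / d) cost (fun h => pairPotential d (G h)) h L σ k := by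
  induction σ generalizing h L k with
  | nil => exact .done h L k
  | cons x σ ih =>
    obtain ⟨k₀, k₁, L', hstep, hserves', rfl⟩ := hserves.exists_serveStep
    exact .request hstep ((hG h x).pairPotential_serveStep_le hd (hcost h x) hL hstep)
      (ih hserves' (hstep.isListing hL) (x :: h))

end AmortizedRun

section MoveToFront

variable {α : Type*} [DecidableEq α]

theorem pairStep_mtf {C : List α} (hC : IsListing C) (x : α) :
    PairStep 2 x (fun y => (before C y x).toNat) (fun y z o => (before C y z ^^ o).toNat)
      (fun y z o => (before (moveTo C x 0) y z ^^ o).toNat) where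
  le y z o _ := (Bool.toNat_le _).trans one_le_two
  other y z o hy hz _ := by rw [before_moveTo_of_ne hC (Nat.zero_le _) hy hz]
  fst y hy := by
    rw [before_moveTo_left hC (Nat.zero_le _) hy, hC.before_swap hy]
    generalize before C y x = l
    revert l
    simp only [Nat.zero_le, decide_true]
    decide
  snd y _ := by
    rw [before_moveTo_right hC (Nat.zero_le _)]
    generalize before C y x = l
    revert l
    simp only [Nat.not_lt_zero, decide_false]
    decide

variable [Fintype α]

/-- The number of pairs of items on whose order the list `C` of an algorithm and the list `L` of the
adversary disagree. -/
noncomputable def inversions (C L : List α) : ℝ :=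
  pairPotential 1 (fun x y o => (before C x y ^^ o).toNat) L

theorem accessCost_add_inversions_le {C L L' : List α} (hC : IsListing C) (hL : IsListing L)
    {x : α} {c : ℕ} (h : ServeStep L x c L') :
    accessCost C x + inversions (moveTo C x 0) L' ≤ 2 * c + inversions C L := by
  simpa [inversions] using
    (pairStep_mtf hC x).pairPotential_serveStep_le (cost := accessCost C x) one_pos
      (by rw [accessCost, hC.idxOf_eq_sum]; omega) hL h

theorem inversions_nonneg (C L : List α) : 0 ≤ inversions C L := pairPotential_nonneg _ _ _

theorem inversions_le (C L : List α) : inversions C L ≤ (Fintype.card α : ℝ) ^ 2 :=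
  (pairPotential_le 1 (c := 2) (fun _ _ _ _ => (Bool.toNat_le _).trans one_le_two) L).trans_eq
    (by norm_num)

end MoveToFront

section Alternating

variable {α : Type*} [DecidableEq α]

theorem before_listAfter_cons_of_ne {R : Rule α} (hR : R.IsForward) {L₀ : List α}
    (hL₀ : IsListing L₀) (h : List α) {x y z : α} (hy : y ≠ x) (hz : z ≠ x) :
    before (listAfter R L₀ (x :: h)) y z = before (listAfter R L₀ h) y z :=
  before_moveTo_of_ne (hL₀.listAfter hR h) (hR _ _ _) hy hz

/-- A rule that leaves a requested item `x` where it is if `q h x`, and moves it to the front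
otherwise, where `q h x` alternates with the requests to `x`. -/
structure IsAlternating (R : Rule α) (q : List α → α → Bool) : Prop where
  rule_eq : ∀ h L x, R h L x = if q h x then L.idxOf x else 0
  cons_self : ∀ h x, q (x :: h) x = !q h x
  cons_of_ne : ∀ h x y, y ≠ x → q (x :: h) y = q h y

/-- Whether the number of past requests to `x` is odd. -/
def oddCount (h : List α) (x : α) : Bool := decide (Odd (h.count x))

theorem oddCount_cons_self (h : List α) (x : α) : oddCount (x :: h) x = !oddCount h x := by
  rw [oddCount, oddCount, List.count_cons_self, ← decide_not, decide_eq_decide, Nat.odd_add_one]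

theorem oddCount_cons_of_ne (h : List α) {x y : α} (hy : y ≠ x) :
    oddCount (x :: h) y = oddCount h y := by
  rw [oddCount, oddCount, List.count_cons_of_ne hy.symm]

theorem isAlternating_mtfo : IsAlternating (α := α) mtfo oddCount where
  rule_eq h L x := by
    by_cases hx : Even (h.count x) <;> simp [mtfo, oddCount, hx, ← Nat.not_even_iff_odd]
  cons_self := oddCount_cons_self
  cons_of_ne h _ _ := oddCount_cons_of_ne h

theorem isAlternating_mtfe : IsAlternating (α := α) mtfe fun h x => !oddCount h x where
  rule_eq h L x := by by_cases hx : Odd (h.count x) <;> simp [mtfe, oddCount, hx]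
  cons_self h x := congrArg not (oddCount_cons_self h x)
  cons_of_ne h _ _ hy := congrArg not (oddCount_cons_of_ne h hy)

/-- The potential of an alternating rule on a pair of items, for costs multiplied by `2`. The
items stay where they are on their next requests if `p` and `q`, respectively, and `l` and `o`
tell whether the first item precedes the second one in the list of the rule and in the list of the
adversary. -/
def alternatingPot (p q l o : Bool) : ℕ :=
  -- Charge 1 if the rule moves the item that is behind in the adversary's list on its next request;
  -- an inversion costs 2, and 2 more if the item in front there stays put on its next request.
  (!(if o then q else p)).toNat + if l = o then 0 else 2 + 2 * (if o then p else q).toNat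

theorem alternatingPot_le : ∀ p q l o, alternatingPot p q l o ≤ 5 := by decide

theorem alternatingPot_fst : ∀ p q l o o' : Bool, (o → o') →
    alternatingPot (!p) q (if p then l else true) o' + 2 * (!l).toNat ≤
      alternatingPot p q l o + 5 * (!o).toNat := by decide

theorem alternatingPot_snd : ∀ p q l o o' : Bool, (o' → o) →
    alternatingPot p (!q) (if q then l else false) o' + 2 * l.toNat ≤
      alternatingPot p q l o + 5 * o.toNat := by decide

namespace IsAlternating

variable {R : Rule α} {q : List α → α → Bool} (hR : IsAlternating R q)
include hR

theorem isForward : R.IsForward := fun h L x => by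
  rw [hR.rule_eq]
  split_ifs
  exacts [le_rfl, Nat.zero_le _]

theorem before_listAfter_cons_right {L₀ : List α} (hL₀ : IsListing L₀) (h : List α) (x y : α) :
    before (listAfter R L₀ (x :: h)) y x =
      if q h x then before (listAfter R L₀ h) y x else false := by
  rw [listAfter, before_moveTo_right (hL₀.listAfter hR.isForward h) (hR.isForward _ _ _),
    hR.rule_eq, before]
  split_ifs <;> simp

theorem before_listAfter_cons_left {L₀ : List α} (hL₀ : IsListing L₀) (h : List α) {x y : α}
    (hy : y ≠ x) : before (listAfter R L₀ (x :: h)) x y =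
      if q h x then before (listAfter R L₀ h) x y else true := by
  rw [(hL₀.listAfter hR.isForward _).before_swap hy, hR.before_listAfter_cons_right hL₀,
    (hL₀.listAfter hR.isForward _).before_swap hy.symm]
  split_ifs <;> simp

end IsAlternating

/-- The potential `alternatingPot` after the requests `h`, for an alternating rule that starts from
the list `L₀`. -/
def alternatingPotAfter (R : Rule α) (q : List α → α → Bool) (L₀ h : List α) (x y : α) (o : Bool) :
    ℕ :=
  alternatingPot (q h x) (q h y) (before (listAfter R L₀ h) x y) o

namespace IsAlternating

variable {R : Rule α} {q : List α → α → Bool}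

theorem pairStep (hR : IsAlternating R q) {L₀ : List α} (hL₀ : IsListing L₀) (h : List α)
    (x : α) :
    PairStep 5 x (fun y => 2 * (before (listAfter R L₀ h) y x).toNat)
      (alternatingPotAfter R q L₀ h) (alternatingPotAfter R q L₀ (x :: h)) where
  le _ _ _ _ := alternatingPot_le _ _ _ _
  other y z o hy hz _ := by
    rw [alternatingPotAfter, alternatingPotAfter, hR.cons_of_ne h x y hy, hR.cons_of_ne h x z hz,
      before_listAfter_cons_of_ne hR.isForward hL₀ h hy hz]
  fst y hy o o' ho := by
    rw [alternatingPotAfter, alternatingPotAfter, hR.cons_self, hR.cons_of_ne h x y hy,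
      hR.before_listAfter_cons_left hL₀ h hy,
      (hL₀.listAfter hR.isForward h).before_swap hy.symm]
    exact alternatingPot_fst _ _ _ _ _ ho
  snd y hy o o' ho := by
    rw [alternatingPotAfter, alternatingPotAfter, hR.cons_self, hR.cons_of_ne h x y hy,
      hR.before_listAfter_cons_right hL₀ h]
    exact alternatingPot_snd _ _ _ _ _ ho

theorem amortizedRun [Fintype α] (hR : IsAlternating R q) {L₀ σ : List α} (hL₀ : IsListing L₀)
    {c : ℕ} (hserves : Serves L₀ σ c) :
    AmortizedRun (5 / 2) (costAfter R L₀) (fun h => pairPotential 2 (alternatingPotAfter R q L₀ h))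
      [] L₀ σ c :=
  hserves.amortizedRun two_pos (hR.pairStep hL₀) (fun h x => by
    rw [costAfter, accessCost, (hL₀.listAfter hR.isForward h).idxOf_eq_sum, ← Finset.mul_sum]
    omega) hL₀ []

end IsAlternating

end Alternating

section Timestamp

variable {α : Type*} [DecidableEq α]

/-- How many requests have been made since the last request to `x`, when `h` are the past requests
(most recent first). Fictitious requests precede them: two successive ones to every item, those to
the first item of the initial list `L₀` being the most recent. -/
def lastAge (L₀ : List α) : List α → α → ℕ
  | [], x => 2 * L₀.idxOf x
  | y :: h, x => if x = y then 0 else lastAge L₀ h x + 1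

/-- The analogue of `lastAge` for the second last request to `x`. -/
def secondAge (L₀ : List α) : List α → α → ℕ
  | [], x => 2 * L₀.idxOf x + 1
  | y :: h, x => if x = y then lastAge L₀ h x + 1 else secondAge L₀ h x + 1

section Ages

variable (L₀ h : List α) {x y : α}

theorem lastAge_cons_self (x : α) : lastAge L₀ (x :: h) x = 0 := if_pos rfl

theorem lastAge_cons_of_ne (hy : y ≠ x) : lastAge L₀ (x :: h) y = lastAge L₀ h y + 1 := if_neg hy

theorem secondAge_cons_self (x : α) : secondAge L₀ (x :: h) x = lastAge L₀ h x + 1 := if_pos rfl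

theorem secondAge_cons_of_ne (hy : y ≠ x) : secondAge L₀ (x :: h) y = secondAge L₀ h y + 1 :=
  if_neg hy

theorem lastAge_lt_secondAge (x : α) : lastAge L₀ h x < secondAge L₀ h x := by
  induction h with
  | nil => exact Nat.lt_succ_self _
  | cons z h ih =>
    rcases eq_or_ne x z with rfl | hx
    · rw [lastAge_cons_self, secondAge_cons_self]
      exact Nat.succ_pos _
    · rw [lastAge_cons_of_ne L₀ h hx, secondAge_cons_of_ne L₀ h hx]
      omega

theorem secondAge_of_notMem (hx : x ∉ h) : secondAge L₀ h x = lastAge L₀ h x + 1 := by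
  induction h with
  | nil => rfl
  | cons z h ih =>
    rw [List.mem_cons, not_or] at hx
    rw [lastAge_cons_of_ne L₀ h hx.1, secondAge_cons_of_ne L₀ h hx.1, ih hx.2]

variable {L₀}

theorem lastAge_injective (hL₀ : IsListing L₀) : Function.Injective (lastAge L₀ h) := by
  induction h with
  | nil => exact fun x y hxy => hL₀.idxOf_injective (Nat.eq_of_mul_eq_mul_left two_pos hxy)
  | cons z h ih =>
    intro x y hxy
    simp only [lastAge] at hxy
    split_ifs at hxy with hx hy
    · exact hx.trans hy.symm
    · exact ih (Nat.succ_injective hxy)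

theorem lastAge_ne_secondAge (hL₀ : IsListing L₀) (x y : α) :
    lastAge L₀ h x ≠ secondAge L₀ h y := by
  induction h with
  | nil =>
    simp only [lastAge, secondAge]
    omega
  | cons z h ih =>
    simp only [lastAge, secondAge]
    split_ifs with hx hy hy
    · omega
    · omega
    · have := (lastAge_injective h hL₀).ne (hy ▸ hx : x ≠ y)
      omega
    · omega

variable (L₀) {h}

theorem count_takeWhile_eq_zero_iff (hx : x ∈ h) (hy : y ≠ x) :
    (h.takeWhile fun z => decide (z ≠ x)).count y = 0 ↔ lastAge L₀ h x < lastAge L₀ h y := by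
  induction h with
  | nil => cases hx
  | cons z h ih =>
    rcases eq_or_ne x z with rfl | hxz
    · simp [lastAge, hy]
    · have := ih ((List.mem_cons.1 hx).resolve_left hxz)
      rcases eq_or_ne y z with rfl | hyz
      · simp [lastAge, hy]
      · simpa [lastAge, List.takeWhile_cons, hxz.symm, hxz, hyz, hyz.symm] using this

theorem count_takeWhile_le_one_iff (hx : x ∈ h) (hy : y ≠ x) :
    (h.takeWhile fun z => decide (z ≠ x)).count y ≤ 1 ↔ lastAge L₀ h x < secondAge L₀ h y := by
  induction h with
  | nil => cases hx
  | cons z h ih =>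
    rcases eq_or_ne x z with rfl | hxz
    · simp [lastAge, secondAge, hy]
    · have hxh := (List.mem_cons.1 hx).resolve_left hxz
      rcases eq_or_ne y z with rfl | hyz
      · simpa [lastAge, secondAge, hxz.symm, hxz] using count_takeWhile_eq_zero_iff L₀ hxh hy
      · simpa [lastAge, secondAge, List.takeWhile_cons, hxz.symm, hxz, hyz, hyz.symm]
          using ih hxh

end Ages

theorem count_takeWhile_self (h : List α) (x : α) :
    (h.takeWhile fun z => decide (z ≠ x)).count x = 0 :=
  List.count_eq_zero.2 fun hx => by simpa using List.mem_takeWhile_imp hx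

theorem isForward_timestamp : (timestamp : Rule α).IsForward := fun h L x => by
  rw [timestamp]
  split_ifs
  · refine List.findIdx_le_findIdx fun y _ hy => ?_
    rw [eq_of_beq hy, count_takeWhile_self]
    rfl
  · exact le_rfl

theorem idxOf_lt_findIdx_iff {L : List α} (hL : L.Nodup) {p : α → Bool}
    (hp : ∀ y z, L.idxOf y < L.idxOf z → p y → p z) {y : α} (hy : y ∈ L) :
    L.idxOf y < L.findIdx p ↔ ¬p y := by
  constructor
  · intro hlt
    have := List.not_of_lt_findIdx hlt
    rw [List.getElem_idxOf] at this
    simp [this]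
  · contrapose!
    intro hle
    have hlt : L.findIdx p < L.length := hle.trans_lt (List.idxOf_lt_length_of_mem hy)
    have hget : p L[L.findIdx p] := List.findIdx_getElem
    have hidx := hL.idxOf_getElem _ hlt
    rcases hle.lt_or_eq with hlt' | heq
    · exact hp _ y (hidx.trans_lt hlt') hget
    · rwa [← (List.idxOf_inj (List.getElem_mem hlt)).1 (hidx.trans heq)]

theorem before_moveTo_timestamp {L₀ L : List α} (hL : IsListing L) {h : List α}
    (hsorted : ∀ y z, before L y z = decide (secondAge L₀ h y < secondAge L₀ h z)) (x y : α) :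
    before (moveTo L x (timestamp h L x)) y x = decide (secondAge L₀ h y ≤ lastAge L₀ h x) := by
  have hsorted' : ∀ y z, L.idxOf y < L.idxOf z ↔ secondAge L₀ h y < secondAge L₀ h z :=
    fun y z => decide_eq_decide.1 (hsorted y z)
  rw [before_moveTo_right hL (isForward_timestamp h L x), decide_eq_decide, timestamp]
  split_ifs with hx
  · have count_le_one_iff : ∀ z, (h.takeWhile fun z => decide (z ≠ x)).count z ≤ 1 ↔
        lastAge L₀ h x < secondAge L₀ h z := fun z => by
      rcases eq_or_ne z x with rfl | hz
      · simp only [count_takeWhile_self, zero_le, lastAge_lt_secondAge]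
      · exact count_takeWhile_le_one_iff L₀ hx hz
    simp only [count_le_one_iff]
    rw [idxOf_lt_findIdx_iff hL.nodup _ (hL.complete y), decide_eq_true_eq, not_lt]
    simp only [decide_eq_true_eq]
    exact fun y z hyz hy => hy.trans ((hsorted' y z).1 hyz)
  · rw [hsorted', secondAge_of_notMem L₀ h hx, Nat.lt_succ_iff]

theorem before_listAfter_timestamp {L₀ : List α} (hL₀ : IsListing L₀) (h : List α) (y z : α) :
    before (listAfter timestamp L₀ h) y z = decide (secondAge L₀ h y < secondAge L₀ h z) := by
  induction h generalizing y z with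
  | nil =>
    rw [listAfter, before, decide_eq_decide, secondAge, secondAge]
    omega
  | cons x h ih =>
    have before_right : ∀ y, y ≠ x → before (listAfter timestamp L₀ (x :: h)) y x =
        decide (secondAge L₀ (x :: h) y < secondAge L₀ (x :: h) x) := fun y hy => by
      rw [listAfter, before_moveTo_timestamp (hL₀.listAfter isForward_timestamp h) ih,
        decide_eq_decide, secondAge_cons_self, secondAge_cons_of_ne L₀ h hy]
      have := lastAge_ne_secondAge h hL₀ x y
      omega
    rcases eq_or_ne z x with rfl | hz
    · rcases eq_or_ne y z with rfl | hy
      · simp [before]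
      · exact before_right y hy
    · rcases eq_or_ne y x with rfl | hy
      · rw [(hL₀.listAfter isForward_timestamp _).before_swap hz, before_right z hz, ← decide_not,
          decide_eq_decide, secondAge_cons_self, secondAge_cons_of_ne L₀ h hz]
        have := lastAge_ne_secondAge h hL₀ y z
        omega
      · rw [before_listAfter_cons_of_ne isForward_timestamp hL₀ h hy hz, ih, decide_eq_decide,
          secondAge_cons_of_ne L₀ h hy, secondAge_cons_of_ne L₀ h hz, Nat.succ_lt_succ_iff]

end Timestamp

section Interleaving

/-- How the last two requests to `x` and the last two requests to `y` interleave, the most recent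
one coming first. -/
inductive Interleaving
  | xxyy
  | xyxy
  | xyyx
  | yxxy
  | yxyx
  | yyxx

namespace Interleaving

/-- The interleaving after one more request to `x`. -/
def requestFst : Interleaving → Interleaving
  | xxyy | xyxy | xyyx => xxyy
  | yxxy | yxyx => xyxy
  | yyxx => xyyx

/-- The interleaving after one more request to `y`. -/
def requestSnd : Interleaving → Interleaving
  | yyxx | yxyx | yxxy => yyxx
  | xyxy | xyyx => yxyx
  | xxyy => yxxy

/-- Whether `x` precedes `y` in the list of Timestamp, which is sorted by the second last
requests. -/
def timestampOrder : Interleaving → Bool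
  | xxyy | xyxy | yxxy => true
  | xyyx | yxyx | yyxx => false

/-- Whether `x` precedes `y` in the list of an alternating rule, when `p` and `q` tell whether `x`
and `y` stay where they are on their next requests. The last request that moved `x` is the last
one to `x` if `p`, and the second last one otherwise. -/
def alternatingOrder (p q : Bool) : Interleaving → Bool
  | xxyy => true
  | xyxy => p || !q
  | xyyx => p
  | yxxy => !q
  | yxyx => p && !q
  | yyxx => false

theorem alternatingOrder_requestFst (p q : Bool) (I : Interleaving) :
    alternatingOrder (!p) q I.requestFst = if p then alternatingOrder p q I else true := by
  cases I <;> revert p q <;> decide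

theorem alternatingOrder_requestSnd (p q : Bool) (I : Interleaving) :
    alternatingOrder p (!q) I.requestSnd = if q then alternatingOrder p q I else false := by
  cases I <;> revert p q <;> decide

/-- The potential of Timestamp on a pair of items; `o` tells whether the first of them precedes the
second one in the list of the adversary. -/
def timestampPot (o : Bool) : Interleaving → ℕ
  | xxyy => 2 * (!o).toNat
  | yyxx => 2 * o.toNat
  | xyxy => (!o).toNat
  | yxyx => o.toNat
  | xyyx | yxxy => 1

theorem timestampPot_le (o : Bool) (I : Interleaving) : timestampPot o I ≤ 2 := by
  cases I <;> revert o <;> decide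

theorem timestampPot_fst (I : Interleaving) (o o' : Bool) (ho : o → o') :
    timestampPot o' I.requestFst + (!I.timestampOrder).toNat ≤
      timestampPot o I + 2 * (!o).toNat := by
  cases I <;> revert o o' <;> decide

theorem timestampPot_snd (I : Interleaving) (o o' : Bool) (ho : o' → o) :
    timestampPot o' I.requestSnd + I.timestampOrder.toNat ≤ timestampPot o I + 2 * o.toNat := by
  cases I <;> revert o o' <;> decide

/-- The joint potential of MTFO, MTFE and Timestamp on a pair of items, which have been requested
equally often modulo `2` if `e`; `o` tells whether the first of them precedes the second one in the
list of the adversary. -/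
def jointPot (e o : Bool) : Interleaving → ℕ
  | xxyy => 5 * (!o).toNat
  | yyxx => 5 * o.toNat
  | xyxy => if e then 4 * (!o).toNat else 1 + (!o).toNat
  | yxyx => if e then 4 * o.toNat else 1 + o.toNat
  | xyyx | yxxy => 2

theorem jointPot_le (e o : Bool) (I : Interleaving) : jointPot e o I ≤ 5 := by
  cases I <;> revert e o <;> decide

theorem jointPot_fst (p q : Bool) (I : Interleaving) (o o' : Bool) (ho : o → o') :
    jointPot ((!p) == q) o' I.requestFst + ((!alternatingOrder p q I).toNat
      + (!alternatingOrder (!p) (!q) I).toNat + (!I.timestampOrder).toNat) ≤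
      jointPot (p == q) o I + 5 * (!o).toNat := by
  cases I <;> revert p q o o' <;> decide

theorem jointPot_snd (p q : Bool) (I : Interleaving) (o o' : Bool) (ho : o' → o) :
    jointPot (p == !q) o' I.requestSnd + ((alternatingOrder p q I).toNat
      + (alternatingOrder (!p) (!q) I).toNat + I.timestampOrder.toNat) ≤
      jointPot (p == q) o I + 5 * o.toNat := by
  cases I <;> revert p q o o' <;> decide

end Interleaving

open Interleaving

variable {α : Type*} [DecidableEq α]

/-- The interleaving of the requests to `x` and `y` after the requests `h`, on the initial list `L₀`
(see `lastAge` for the items that have been requested less than twice). -/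
def interleaving (L₀ h : List α) (x y : α) : Interleaving :=
  if secondAge L₀ h x < lastAge L₀ h y then xxyy
  else if secondAge L₀ h y < lastAge L₀ h x then yyxx
  else if lastAge L₀ h x < lastAge L₀ h y then
    if secondAge L₀ h x < secondAge L₀ h y then xyxy else xyyx
  else if secondAge L₀ h x < secondAge L₀ h y then yxxy else yxyx

theorem interleaving_cons_of_ne (L₀ h : List α) {x y z : α} (hy : y ≠ x) (hz : z ≠ x) :
    interleaving L₀ (x :: h) y z = interleaving L₀ h y z := by
  simp only [interleaving, lastAge_cons_of_ne L₀ h hy, lastAge_cons_of_ne L₀ h hz,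
    secondAge_cons_of_ne L₀ h hy, secondAge_cons_of_ne L₀ h hz, Nat.succ_lt_succ_iff]

variable {L₀ : List α} (hL₀ : IsListing L₀) (h : List α)
include hL₀

theorem interleaving_cons_left {x y : α} (hy : y ≠ x) :
    interleaving L₀ (x :: h) x y = (interleaving L₀ h x y).requestFst := by
  have hxy := lastAge_ne_secondAge h hL₀ x y
  have hx := lastAge_lt_secondAge L₀ h x
  have hy' := lastAge_lt_secondAge L₀ h y
  simp only [interleaving, lastAge_cons_self, secondAge_cons_self, lastAge_cons_of_ne L₀ h hy,
    secondAge_cons_of_ne L₀ h hy]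
  split_ifs <;> first | rfl | omega

theorem interleaving_cons_right {x y : α} (hy : y ≠ x) :
    interleaving L₀ (x :: h) y x = (interleaving L₀ h y x).requestSnd := by
  have hlast := (lastAge_injective h hL₀).ne hy
  have hxy := lastAge_ne_secondAge h hL₀ x y
  have hx := lastAge_lt_secondAge L₀ h x
  have hy' := lastAge_lt_secondAge L₀ h y
  simp only [interleaving, lastAge_cons_self, secondAge_cons_self, lastAge_cons_of_ne L₀ h hy,
    secondAge_cons_of_ne L₀ h hy]
  split_ifs <;> first | rfl | omega

theorem before_listAfter_timestamp_eq_timestampOrder (x y : α) :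
    before (listAfter timestamp L₀ h) x y = (interleaving L₀ h x y).timestampOrder := by
  have hx := lastAge_lt_secondAge L₀ h x
  have hy := lastAge_lt_secondAge L₀ h y
  rw [before_listAfter_timestamp hL₀, interleaving]
  split_ifs <;> simp only [timestampOrder, decide_eq_true_eq, decide_eq_false_iff_not] <;> omega

theorem IsAlternating.before_listAfter_eq_alternatingOrder {R : Rule α} {q : List α → α → Bool}
    (hR : IsAlternating R q) {x y : α} (hxy : x ≠ y) :
    before (listAfter R L₀ h) x y = alternatingOrder (q h x) (q h y) (interleaving L₀ h x y) := by
  induction h generalizing x y with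
  | nil =>
    rw [listAfter, before, interleaving]
    rcases (hL₀.idxOf_injective.ne hxy).lt_or_gt with hlt | hgt
    · rw [if_pos (by simp only [lastAge, secondAge]; omega)]
      exact decide_eq_true hlt
    · rw [if_neg (by simp only [lastAge, secondAge]; omega),
        if_pos (by simp only [lastAge, secondAge]; omega)]
      exact decide_eq_false hgt.not_gt
  | cons z h ih =>
    rcases eq_or_ne x z with rfl | hx
    · rw [hR.before_listAfter_cons_left hL₀ h hxy.symm, ih hxy, hR.cons_self,
        hR.cons_of_ne h x y hxy.symm, interleaving_cons_left hL₀ h hxy.symm,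
        alternatingOrder_requestFst]
    · rcases eq_or_ne y z with rfl | hy
      · rw [hR.before_listAfter_cons_right hL₀ h, ih hxy, hR.cons_self, hR.cons_of_ne h y x hxy,
          interleaving_cons_right hL₀ h hxy, alternatingOrder_requestSnd]
      · rw [before_listAfter_cons_of_ne hR.isForward hL₀ h hx hy, ih hxy, hR.cons_of_ne h z x hx,
          hR.cons_of_ne h z y hy, interleaving_cons_of_ne L₀ h hx hy]

end Interleaving

section Candidates

open Interleaving

variable {α : Type*} [DecidableEq α] {L₀ : List α} (hL₀ : IsListing L₀)
include hL₀

theorem pairStep_timestamp (h : List α) (x : α) :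
    PairStep 2 x (fun y => (before (listAfter timestamp L₀ h) y x).toNat)
      (fun y z o => timestampPot o (interleaving L₀ h y z))
      (fun y z o => timestampPot o (interleaving L₀ (x :: h) y z)) where
  le _ _ _ _ := timestampPot_le _ _
  other y z o hy hz _ := by rw [interleaving_cons_of_ne L₀ h hy hz]
  fst y hy o o' ho := by
    rw [interleaving_cons_left hL₀ h hy,
      (hL₀.listAfter isForward_timestamp h).before_swap hy.symm,
      before_listAfter_timestamp_eq_timestampOrder hL₀]
    exact timestampPot_fst _ o o' ho
  snd y hy o o' ho := by
    rw [interleaving_cons_right hL₀ h hy, before_listAfter_timestamp_eq_timestampOrder hL₀]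
    exact timestampPot_snd _ o o' ho

theorem pairStep_candidates (h : List α) (x : α) :
    PairStep 5 x (fun y => (before (listAfter mtfo L₀ h) y x).toNat
        + (before (listAfter mtfe L₀ h) y x).toNat + (before (listAfter timestamp L₀ h) y x).toNat)
      (fun y z o => jointPot (oddCount h y == oddCount h z) o (interleaving L₀ h y z))
      (fun y z o => jointPot (oddCount (x :: h) y == oddCount (x :: h) z) o
        (interleaving L₀ (x :: h) y z)) where
  le _ _ _ _ := jointPot_le _ _ _
  other y z o hy hz _ := by
    rw [interleaving_cons_of_ne L₀ h hy hz, oddCount_cons_of_ne h hy, oddCount_cons_of_ne h hz]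
  fst y hy o o' ho := by
    rw [interleaving_cons_left hL₀ h hy, oddCount_cons_self, oddCount_cons_of_ne h hy,
      (hL₀.listAfter isAlternating_mtfo.isForward h).before_swap hy.symm,
      (hL₀.listAfter isAlternating_mtfe.isForward h).before_swap hy.symm,
      (hL₀.listAfter isForward_timestamp h).before_swap hy.symm,
      isAlternating_mtfo.before_listAfter_eq_alternatingOrder hL₀ h hy.symm,
      isAlternating_mtfe.before_listAfter_eq_alternatingOrder hL₀ h hy.symm,
      before_listAfter_timestamp_eq_timestampOrder hL₀]
    exact jointPot_fst _ _ _ o o' ho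
  snd y hy o o' ho := by
    rw [interleaving_cons_right hL₀ h hy, oddCount_cons_self, oddCount_cons_of_ne h hy,
      isAlternating_mtfo.before_listAfter_eq_alternatingOrder hL₀ h hy,
      isAlternating_mtfe.before_listAfter_eq_alternatingOrder hL₀ h hy,
      before_listAfter_timestamp_eq_timestampOrder hL₀]
    exact jointPot_snd _ _ _ o o' ho

variable [Fintype α]

theorem ruleCost_timestamp_le (σ : List α) :
    (ruleCost timestamp [] L₀ σ : ℝ) ≤ 2 * opt L₀ σ + (Fintype.card α : ℝ) ^ 2 := by
  have hrun := (serves_opt L₀ σ).amortizedRun one_pos (cost := costAfter timestamp L₀)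
    (pairStep_timestamp hL₀) (fun h x => by
      rw [costAfter, accessCost, (hL₀.listAfter isForward_timestamp h).idxOf_eq_sum]
      omega) hL₀ []
  have hcost := hrun.totalCost_le (by norm_num) fun _ _ => pairPotential_nonneg _ _ _
  have hpot := pairPotential_le 1 (fun y z o _ => timestampPot_le o (interleaving L₀ [] y z)) L₀
  rw [← ruleCost_listAfter, listAfter] at hcost
  norm_num at hcost hpot
  linarith

theorem sum_ruleCost_le (σ : List α) :
    (ruleCost mtfo [] L₀ σ + ruleCost mtfe [] L₀ σ + ruleCost timestamp [] L₀ σ : ℝ) ≤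
      5 * opt L₀ σ + 3 * (Fintype.card α : ℝ) ^ 2 := by
  have hrun := (serves_opt L₀ σ).amortizedRun one_pos
    (cost := fun h x => costAfter mtfo L₀ h x + costAfter mtfe L₀ h x + costAfter timestamp L₀ h x)
    (pairStep_candidates hL₀) (fun h x => by
      simp only [costAfter, accessCost, Finset.sum_add_distrib,
        (hL₀.listAfter isAlternating_mtfo.isForward h).idxOf_eq_sum,
        (hL₀.listAfter isAlternating_mtfe.isForward h).idxOf_eq_sum,
        (hL₀.listAfter isForward_timestamp h).idxOf_eq_sum]
      omega) hL₀ []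
  have hcost := hrun.totalCost_le (by norm_num) fun _ _ => pairPotential_nonneg _ _ _
  have hpot := pairPotential_le 1 (fun y z o _ => jointPot_le
    (oddCount [] y == oddCount [] z) o (interleaving L₀ [] y z)) L₀
  rw [totalCost_add, totalCost_add, ← ruleCost_listAfter, ← ruleCost_listAfter,
    ← ruleCost_listAfter] at hcost
  simp only [listAfter] at hcost
  push_cast at hcost hpot
  nlinarith [sq_nonneg (Fintype.card α : ℝ)]

theorem ruleCost_le_of_trusted {φ : List Bool} {σ : List α} (hφ : Trusted L₀ φ σ) :
    (ruleCost (decode φ).rule [] L₀ σ : ℝ) ≤ 5 / 3 * opt L₀ σ + (Fintype.card α : ℝ) ^ 2 := by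
  have le_mtfo : (ruleCost (decode φ).rule [] L₀ σ : ℝ) ≤ ruleCost mtfo [] L₀ σ :=
    mod_cast hφ .mtfo
  have le_mtfe : (ruleCost (decode φ).rule [] L₀ σ : ℝ) ≤ ruleCost mtfe [] L₀ σ :=
    mod_cast hφ .mtfe
  have le_timestamp : (ruleCost (decode φ).rule [] L₀ σ : ℝ) ≤ ruleCost timestamp [] L₀ σ :=
    mod_cast hφ .timestamp
  linarith [sum_ruleCost_le hL₀ σ]

end Candidates

section Toggling

variable {α : Type*}

namespace TogState

theorem history_endTrusting (m : ℕ) (s : TogState α) : (s.endTrusting m).history = s.history := by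
  unfold endTrusting
  split_ifs <;> rfl

theorem history_endIgnoring (m : ℕ) (β : ℝ) (s : TogState α) :
    (s.endIgnoring m β).history = s.history := by
  unfold endIgnoring
  split_ifs <;> rfl

variable [DecidableEq α]

/-- The invariant of toggling between Move-To-Front and the rule `R` with initial list `L₀`. The
access cost of a trusting phase exceeds its limit by at most `δ` and that of an ignoring phase by
at most `δ'`: these are the cost of a single access before phases that are over are closed, and
`0` afterwards. -/
structure Invariant (m : ℕ) (β : ℝ) (R : Rule α) (L₀ : List α) (δ δ' : ℝ) (s : TogState α) :
    Prop where
  simulated_eq : s.simulated = listAfter R L₀ s.history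
  isListing : IsListing s.current
  current_eq : s.trusting = true → s.current = s.simulated
  trusting_le : s.trusting = true → (s.phaseCost : ℝ) ≤ (m : ℝ) ^ 3 + δ
  ignoring_le : s.trusting = false → (s.phaseCost : ℝ) ≤ β * (m : ℝ) ^ 3 + δ'

namespace Invariant

variable {m : ℕ} {β δ δ' : ℝ} {R : Rule α} {L₀ : List α} {s : TogState α}

theorem init (hL₀ : IsListing L₀) (hδ : 0 ≤ δ) :
    (⟨[], L₀, L₀, true, 0⟩ : TogState α).Invariant m β R L₀ δ δ' where
  simulated_eq := rfl
  isListing := hL₀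
  current_eq _ := rfl
  trusting_le _ := by rw [Nat.cast_zero]; positivity
  ignoring_le := nofun

theorem endTrusting (hs : s.Invariant m β R L₀ δ δ') (hβ : 0 ≤ β) (hδ' : 0 ≤ δ') :
    (s.endTrusting m).Invariant m β R L₀ 0 δ' := by
  unfold TogState.endTrusting
  split_ifs with hover
  · exact ⟨hs.simulated_eq, hs.isListing, nofun, nofun, fun _ => by
      rw [Nat.cast_zero]; positivity⟩
  · refine ⟨hs.simulated_eq, hs.isListing, hs.current_eq, fun ht => ?_, hs.ignoring_le⟩
    have hlt : s.phaseCost < m ^ 3 := not_le.1 fun hle => hover ⟨ht, hle⟩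
    rw [add_zero]
    exact_mod_cast hlt.le

theorem endIgnoring (hs : s.Invariant m β R L₀ 0 δ') (hR : R.IsForward) (hL₀ : IsListing L₀) :
    (s.endIgnoring m β).Invariant m β R L₀ 0 0 := by
  unfold TogState.endIgnoring
  split_ifs with hover
  · refine ⟨hs.simulated_eq, ?_, fun _ => rfl, fun _ => by rw [Nat.cast_zero]; positivity, nofun⟩
    exact hs.simulated_eq ▸ hL₀.listAfter hR s.history
  · refine ⟨hs.simulated_eq, hs.isListing, hs.current_eq, hs.trusting_le, fun ht => ?_⟩
    rw [add_zero]
    exact (not_le.1 fun hle => hover ⟨ht, hle⟩).le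

theorem serve [Fintype α] (hm : Fintype.card α = m) (hs : s.Invariant m β R L₀ 0 0)
    (hR : R.IsForward) (x : α) : (s.serve R x).Invariant m β R L₀ m m where
  simulated_eq := by rw [TogState.serve, hs.simulated_eq, listAfter]
  isListing := by
    refine hs.isListing.moveTo ?_
    split_ifs
    exacts [hR _ _ _, isForward_mtf _ _ _]
  current_eq ht := by
    have ht' : s.trusting = true := ht
    simp only [TogState.serve, ht', if_true, hs.current_eq ht']
  trusting_le ht := by
    have haccess : (accessCost s.current x : ℝ) ≤ m :=
      mod_cast hm ▸ hs.isListing.accessCost_le_card x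
    have hphase := hs.trusting_le ht
    simp only [TogState.serve, Nat.cast_add]
    linarith
  ignoring_le ht := by
    have haccess : (accessCost s.current x : ℝ) ≤ m :=
      mod_cast hm ▸ hs.isListing.accessCost_le_card x
    have hphase := hs.ignoring_le ht
    simp only [TogState.serve, Nat.cast_add]
    linarith

end Invariant

variable [Fintype α]

/-- The potential of toggling against an adversary with list `L`. The access costs of ignoring
phases count `a` times and those of trusting phases `b` times, amortized by the inversions and by
`Φ`, respectively. The difference to the actual costs pays, on the long run, for the changes of
phase. -/
noncomputable def potential (m : ℕ) (a b : ℝ) (Φ : List α → List α → ℝ) (s : TogState α)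
    (L : List α) : ℝ :=
  if s.trusting = true then b * Φ s.history L + (b - 1) * s.phaseCost
  else a * (inversions s.current L - (m : ℝ) ^ 2) + (a - 1) * s.phaseCost
    + ((b - 1) * (m : ℝ) ^ 3 - |b - 1| * m)

end TogState

theorem mul_sub_abs_mul_le_mul {l p δ : ℝ} (t : ℝ) (hl : l ≤ p) (hp : p ≤ l + δ) :
    t * l - |t| * δ ≤ t * p := by
  have habs : |t| * (p - l) ≤ |t| * δ := by gcongr; linarith
  have hneg : -|t| * (p - l) ≤ t * (p - l) :=
    mul_le_mul_of_nonneg_right (neg_abs_le t) (sub_nonneg.2 hl)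
  linarith

namespace TogState

variable [DecidableEq α] [Fintype α] {m : ℕ} {β δ a b B κ : ℝ} {R : Rule α} {L₀ : List α}
  {Φ : List α → List α → ℝ} {s : TogState α}

theorem potential_endTrusting_le (hm : Fintype.card α = m) (ha : 0 ≤ a) (hb : 0 ≤ b)
    (hΦ : ∀ h L, 0 ≤ Φ h L) (hs : s.Invariant m β R L₀ m δ) (L : List α) :
    (s.endTrusting m).potential m a b Φ L ≤ s.potential m a b Φ L := by
  by_cases hover : s.trusting = true ∧ m ^ 3 ≤ s.phaseCost
  · have hphase := mul_sub_abs_mul_le_mul (b - 1) (mod_cast hover.2) (hs.trusting_le hover.1)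
    have hinv : a * (inversions s.current L - (m : ℝ) ^ 2) ≤ 0 :=
      mul_nonpos_of_nonneg_of_nonpos ha (sub_nonpos.2 (hm ▸ inversions_le _ _))
    have hpot : 0 ≤ b * Φ s.history L := mul_nonneg hb (hΦ _ _)
    simp only [endTrusting, potential, hover, and_self, if_true, Bool.false_eq_true, if_false,
      Nat.cast_zero]
    linarith
  · rw [endTrusting, if_neg hover]

theorem exchangeCost_current_simulated_le (hm : Fintype.card α = m) (hR : R.IsForward)
    (hL₀ : IsListing L₀) {δ' : ℝ} (hs : s.Invariant m β R L₀ δ δ') :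
    exchangeCost s.current s.simulated ≤ m ^ 2 := by
  have hsim : IsListing s.simulated := hs.simulated_eq ▸ hL₀.listAfter hR _
  have hperm : s.current.Perm s.simulated :=
    (List.perm_ext_iff_of_nodup hs.isListing.nodup hsim.nodup).2 fun x =>
      iff_of_true (hs.isListing.complete x) (hsim.complete x)
  simpa only [hs.isListing.length_eq_card, hm] using exchangeCost_le hperm

theorem paidCost_add_potential_endIgnoring_le (hm : Fintype.card α = m) (hR : R.IsForward)
    (hL₀ : IsListing L₀) (ha : 0 ≤ a) (hb : 0 ≤ b) (hΦ : ∀ h L, Φ h L ≤ B * (m : ℝ) ^ 2)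
    (hlong : (1 + a + b * B + |a - 1| + |b - 1|) * (m : ℝ) ^ 2 ≤
      ((a - 1) * β + (b - 1)) * (m : ℝ) ^ 3)
    (hs : s.Invariant m β R L₀ δ m) (L : List α) :
    s.paidCost m β + (s.endIgnoring m β).potential m a b Φ L ≤ s.potential m a b Φ L := by
  by_cases hover : s.IgnoringOver m β
  · have hphase := mul_sub_abs_mul_le_mul (a - 1) hover.2 (hs.ignoring_le hover.1)
    have hexch : (exchangeCost s.current s.simulated : ℝ) ≤ (m : ℝ) ^ 2 :=
      mod_cast exchangeCost_current_simulated_le hm hR hL₀ hs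
    have hinv : 0 ≤ a * inversions s.current L := mul_nonneg ha (inversions_nonneg _ _)
    have hpot : b * Φ s.history L ≤ b * (B * (m : ℝ) ^ 2) := by gcongr; exact hΦ _ _
    have hsq : (m : ℝ) ≤ (m : ℝ) ^ 2 := mod_cast Nat.le_self_pow two_ne_zero m
    have hslack : (|a - 1| + |b - 1|) * m ≤ (|a - 1| + |b - 1|) * (m : ℝ) ^ 2 := by gcongr
    simp only [endIgnoring, paidCost, potential, hover, hover.1, if_true, Bool.false_eq_true,
      if_false, Nat.cast_zero]
    linarith
  · rw [endIgnoring, paidCost, if_neg hover, if_neg hover, Nat.cast_zero, zero_add]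

theorem accessCost_add_potential_serve_le (ha : 0 ≤ a) (hb : 0 ≤ b) (hab : b * κ = 2 * a)
    (hs : s.Invariant m β R L₀ 0 0) {L L' : List α} (hL : IsListing L) {x : α} {c : ℕ}
    (hstep : ServeStep L x c L')
    (hcost : costAfter R L₀ s.history x + Φ (x :: s.history) L' ≤ κ * c + Φ s.history L) :
    accessCost s.current x + (s.serve R x).potential m a b Φ L' ≤
      2 * a * c + s.potential m a b Φ L := by
  rcases ht : s.trusting with _ | _
  · have hmtf := mul_le_mul_of_nonneg_left
      (accessCost_add_inversions_le hs.isListing hL hstep) ha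
    simp only [potential, serve, ht, Bool.false_eq_true, if_false, mtf, Nat.cast_add]
    linarith
  · have hrule : b * (costAfter R L₀ s.history x + Φ (x :: s.history) L') ≤
        2 * a * c + b * Φ s.history L := by
      rw [← hab, mul_assoc, ← mul_add]
      gcongr
    rw [costAfter, ← hs.simulated_eq, ← hs.current_eq ht] at hrule
    simp only [potential, serve, ht, if_true, Nat.cast_add]
    linarith

theorem neg_le_potential (hβ : 0 ≤ β) (ha : 0 ≤ a) (hb : 0 ≤ b) (hΦ : ∀ h L, 0 ≤ Φ h L)
    (hs : s.Invariant m β R L₀ m m) (L : List α) :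
    -(a * (m : ℝ) ^ 2 + |a - 1| * (β * (m : ℝ) ^ 3 + m) + |b - 1| * ((m : ℝ) ^ 3 + m)) ≤
      s.potential m a b Φ L := by
  have hphase : 0 ≤ |a - 1| * (β * (m : ℝ) ^ 3 + m) := by positivity
  have hsq : 0 ≤ a * (m : ℝ) ^ 2 := by positivity
  rcases ht : s.trusting with _ | _
  · have hignoring := mul_sub_abs_mul_le_mul (a - 1) s.phaseCost.cast_nonneg
      ((hs.ignoring_le ht).trans_eq (zero_add _).symm)
    have htrusting : -|b - 1| * (m : ℝ) ^ 3 ≤ (b - 1) * (m : ℝ) ^ 3 := by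
      gcongr
      exact neg_abs_le _
    have hinv : 0 ≤ a * inversions s.current L := mul_nonneg ha (inversions_nonneg _ _)
    simp only [potential, ht, Bool.false_eq_true, if_false]
    linarith
  · have htrusting := mul_sub_abs_mul_le_mul (b - 1) s.phaseCost.cast_nonneg
      ((hs.trusting_le ht).trans_eq (zero_add _).symm)
    have hpot : 0 ≤ b * Φ s.history L := mul_nonneg hb (hΦ _ _)
    simp only [potential, ht, if_true]
    linarith

end TogState

variable [DecidableEq α] [Fintype α]

theorem toggleCost_le {m : ℕ} {β a b B κ : ℝ} {R : Rule α} {L₀ : List α}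
    {Φ : List α → List α → ℝ} {s : TogState α} (hm : Fintype.card α = m) (hR : R.IsForward)
    (hL₀ : IsListing L₀) (hβ : 0 ≤ β) (ha : 0 ≤ a) (hb : 0 ≤ b) (hab : b * κ = 2 * a)
    (hΦ : ∀ h L, 0 ≤ Φ h L) (hΦB : ∀ h L, Φ h L ≤ B * (m : ℝ) ^ 2)
    (hlong : (1 + a + b * B + |a - 1| + |b - 1|) * (m : ℝ) ^ 2 ≤
      ((a - 1) * β + (b - 1)) * (m : ℝ) ^ 3)
    (hs : s.Invariant m β R L₀ m m) {L σ : List α} (hL : IsListing L) {c : ℕ}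
    (hrun : AmortizedRun κ (costAfter R L₀) Φ s.history L σ c) :
    toggleCost m β R s σ ≤ 2 * a * c + s.potential m a b Φ L +
      (a * (m : ℝ) ^ 2 + |a - 1| * (β * (m : ℝ) ^ 3 + m) + |b - 1| * ((m : ℝ) ^ 3 + m)) := by
  induction σ generalizing s L c with
  | nil =>
    have hpot := TogState.neg_le_potential hβ ha hb hΦ hs L
    have hopt : 0 ≤ 2 * a * c := by positivity
    rw [toggleCost, Nat.cast_zero]
    linarith
  | cons x σ ih =>
    have hs₁ := hs.endTrusting hβ m.cast_nonneg
    have hs₂ := hs₁.endIgnoring hR hL₀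
    have hpot₁ := TogState.potential_endTrusting_le hm ha hb hΦ hs L
    have hpot₂ := TogState.paidCost_add_potential_endIgnoring_le hm hR hL₀ ha hb hΦB hlong hs₁ L
    rw [← TogState.history_endTrusting m s, ← TogState.history_endIgnoring m β] at hrun
    cases hrun with
    | request hstep hcost hrun =>
      have hserve :=
        TogState.accessCost_add_potential_serve_le (m := m) ha hb hab hs₂ hL hstep hcost
      have hrest := ih (hs₂.serve hm hR x) (hstep.isListing hL) hrun
      rw [toggleCost]
      push_cast
      linarith

open Filter

theorem eventually_mul_sq_le_mul_cube (D : ℝ) {δ : ℝ} (hδ : 0 < δ) :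
    ∀ᶠ m : ℕ in atTop, D * (m : ℝ) ^ 2 ≤ δ * (m : ℝ) ^ 3 := by
  filter_upwards [eventually_ge_atTop ⌈D / δ⌉₊] with m hm
  have hD : D ≤ m * δ := (div_le_iff₀ hδ).1 (Nat.ceil_le.1 hm)
  calc D * (m : ℝ) ^ 2 ≤ m * δ * (m : ℝ) ^ 2 := by gcongr
    _ = δ * (m : ℝ) ^ 3 := by ring

/-- The competitive ratio of toggling against an adversary to which the rule of the trusting
phases loses a factor `κ` and Move-To-Front a factor `2`: in a pair of phases, whose access costs
are in the ratio `1 : β`, the adversary pays in proportion to `1 / κ + β / 2`. -/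
noncomputable def toggleRatio (κ β : ℝ) : ℝ := (1 + β) / (1 / κ + β / 2)

theorem eventually_toggleCost_le {κ β ε : ℝ} (hκ : 0 < κ) (hβ : 0 ≤ β) (hε : 0 < ε) (B : ℝ) :
    ∀ᶠ m : ℕ in atTop, ∃ K : ℝ, ∀ (R : Rule (Fin m)) (L₀ : List (Fin m))
      (Φ : List (Fin m) → List (Fin m) → ℝ), R.IsForward → IsListing L₀ → (∀ h L, 0 ≤ Φ h L) →
      (∀ h L, Φ h L ≤ B * (m : ℝ) ^ 2) → ∀ σ c, AmortizedRun κ (costAfter R L₀) Φ [] L₀ σ c →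
        toggleCost m β R ⟨[], L₀, L₀, true, 0⟩ σ ≤ (toggleRatio κ β + ε) * c + K := by
  set w := toggleRatio κ β + ε with hw
  have hden : 0 < 1 / κ + β / 2 := by positivity
  have hw₀ : 0 ≤ w := by rw [hw, toggleRatio]; positivity
  have hgain : (w / 2 - 1) * β + (w / κ - 1) = ε * (1 / κ + β / 2) := by
    have hratio : toggleRatio κ β * (1 / κ + β / 2) = 1 + β := div_mul_cancel₀ _ hden.ne'
    linear_combination hratio + (1 / κ + β / 2) * hw
  filter_upwards [eventually_mul_sq_le_mul_cube
    (1 + w / 2 + w / κ * B + |w / 2 - 1| + |w / κ - 1|) (mul_pos hε hden)] with m hm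
  refine ⟨w / κ * (B * (m : ℝ) ^ 2) + (w / 2 * (m : ℝ) ^ 2 + |w / 2 - 1| * (β * (m : ℝ) ^ 3 + m)
    + |w / κ - 1| * ((m : ℝ) ^ 3 + m)), fun R L₀ Φ hR hL₀ hΦ hΦB σ c hrun => ?_⟩
  have htoggle := toggleCost_le (a := w / 2) (b := w / κ) (Fintype.card_fin m) hR hL₀ hβ
    (by positivity) (by positivity) (by field_simp) hΦ hΦB (hgain ▸ hm)
    (s := ⟨[], L₀, L₀, true, 0⟩) (.init hL₀ m.cast_nonneg) hL₀ hrun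
  have hpot : w / κ * Φ [] L₀ ≤ w / κ * (B * (m : ℝ) ^ 2) := by gcongr; exact hΦB _ _
  simp only [TogState.potential, if_true, Nat.cast_zero, mul_zero, add_zero] at htoggle
  linarith

end Toggling

section Competitiveness

open Filter

theorem isListing_of_perm_finRange {m : ℕ} {L : List (Fin m)} (h : L.Perm (List.finRange m)) :
    IsListing L :=
  .perm ⟨List.nodup_finRange m, List.mem_finRange⟩ h.symm

theorem togCost_eq_ruleCost_or_toggleCost {α : Type*} [DecidableEq α] (m : ℕ) (β : ℝ)
    (φ : List Bool) :
    ((decode φ).rule = (timestamp : Rule α) ∧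
      ∀ L σ : List α, togCost m β L φ σ = ruleCost timestamp [] L σ) ∨
    ((∃ q, IsAlternating ((decode φ).rule : Rule α) q) ∧
      ∀ L σ : List α,
        togCost m β L φ σ = toggleCost m β (decode φ).rule ⟨[], L, L, true, 0⟩ σ) := by
  unfold togCost
  rcases decode φ with _ | _ | _
  · exact .inl ⟨rfl, fun _ _ => rfl⟩
  · exact .inr ⟨⟨_, isAlternating_mtfo⟩, fun _ _ => rfl⟩
  · exact .inr ⟨⟨_, isAlternating_mtfe⟩, fun _ _ => rfl⟩

variable {β ε : ℝ}

theorem eventually_togCost_le_of_trusted (hβ : 0 ≤ β) (hε : 0 < ε) :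
    ∀ᶠ m : ℕ in atTop, ∃ K : ℝ, ∀ L : List (Fin m), IsListing L → ∀ σ φ, Trusted L φ σ →
      togCost m β L φ σ ≤ (5 / 3 + 5 * β / (6 + 3 * β) + ε) * opt L σ + K := by
  filter_upwards [eventually_toggleCost_le one_pos hβ (ε := 3 / 5 * ε) (by positivity) 0]
    with m ⟨K, hK⟩
  set ρ := toggleRatio 1 β + 3 / 5 * ε with hρ
  have hρr : 5 / 3 * ρ = 5 / 3 + 5 * β / (6 + 3 * β) + ε := by
    rw [hρ, toggleRatio]
    field_simp
    ring
  have hρ₁ : 1 ≤ ρ := by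
    have : 0 ≤ 5 * β / (6 + 3 * β) := by positivity
    linarith
  refine ⟨ρ * (m : ℝ) ^ 2 + |K|, fun L hL σ φ hφ => ?_⟩
  have hcandidate := ruleCost_le_of_trusted hL hφ
  rw [Fintype.card_fin] at hcandidate
  calc (togCost m β L φ σ : ℝ) ≤ ρ * ruleCost (decode φ).rule [] L σ + |K| := by
        rcases togCost_eq_ruleCost_or_toggleCost (α := Fin m) m β φ with
          ⟨hrule, hcost⟩ | ⟨⟨q, hq⟩, hcost⟩
        · rw [hcost, hrule]
          exact (le_mul_of_one_le_left (Nat.cast_nonneg _) hρ₁).trans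
            (le_add_of_nonneg_right (abs_nonneg K))
        · have htoggle := hK _ L 0 hq.isForward hL (fun _ _ => le_rfl)
            (fun _ _ => (zero_mul _).ge) σ _ (amortizedRun_self hq.isForward L [] σ)
          rw [listAfter] at htoggle
          rw [hcost]
          exact htoggle.trans (by gcongr; exact le_abs_self K)
    _ ≤ ρ * (5 / 3 * opt L σ + (m : ℝ) ^ 2) + |K| := by gcongr
    _ = _ := by rw [← hρr]; ring

theorem eventually_togCost_le (hβ : 0 ≤ β) (hε : 0 < ε) :
    ∀ᶠ m : ℕ in atTop, ∃ K : ℝ, ∀ L : List (Fin m), IsListing L → ∀ σ φ,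
      togCost m β L φ σ ≤ (2 + 2 / (4 + 5 * β) + ε) * opt L σ + K := by
  filter_upwards [eventually_toggleCost_le (by norm_num : (0 : ℝ) < 5 / 2) hβ hε (5 / 4)]
    with m ⟨K, hK⟩
  have hratio : toggleRatio (5 / 2) β = 2 + 2 / (4 + 5 * β) := by
    rw [toggleRatio]
    field_simp
    ring
  refine ⟨max ((m : ℝ) ^ 2) K, fun L hL σ φ => ?_⟩
  rcases togCost_eq_ruleCost_or_toggleCost (α := Fin m) m β φ with ⟨-, hcost⟩ | ⟨⟨q, hq⟩, hcost⟩
  · have htimestamp := ruleCost_timestamp_le hL σ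
    rw [Fintype.card_fin] at htimestamp
    rw [hcost]
    refine htimestamp.trans ?_
    gcongr
    · have : 0 ≤ 2 / (4 + 5 * β) := by positivity
      linarith
    · exact le_max_left _ _
  · have htoggle := hK _ L _ hq.isForward hL (fun h => pairPotential_nonneg _ _)
      (fun h L' =>
        (pairPotential_le 2 (c := 5) (fun _ _ _ _ => alternatingPot_le _ _ _ _) L').trans_eq
          (by norm_num)) σ _ (hq.amortizedRun hL (serves_opt L σ))
    rw [hcost, ← hratio]
    exact htoggle.trans (by gcongr; exact le_max_right _ _)

theorem togCompetitive (hβ : 0 ≤ β) :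
    TogCompetitive β (5 / 3 + 5 * β / (6 + 3 * β)) (2 + 2 / (4 + 5 * β)) := by
  intro ε hε
  obtain ⟨m₀, hm₀⟩ := eventually_atTop.1
    ((eventually_togCost_le_of_trusted hβ hε).and (eventually_togCost_le hβ hε))
  refine ⟨m₀, fun m hm => ?_⟩
  obtain ⟨⟨K, hK⟩, ⟨K', hK'⟩⟩ := hm₀ m hm
  refine ⟨max K K', fun L hperm σ => ⟨fun φ hφ => ?_, fun φ => ?_⟩⟩
  · exact (hK L (isListing_of_perm_finRange hperm) σ φ hφ).trans (by gcongr; exact le_max_left _ _)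
  · exact (hK' L (isListing_of_perm_finRange hperm) σ φ).trans (by gcongr; exact le_max_right _ _)

theorem exists_parameter {r : ℝ} (hr : 5 / 3 ≤ r) (hr₂ : r ≤ 2) :
    ∃ β : ℝ, 0 ≤ β ∧ β ≤ 1 / 2 ∧ r = 5 / 3 + 5 * β / (6 + 3 * β) ∧
      2 / (4 + 5 * β) = (10 - 3 * r) / (9 * r - 5) := by
  have hden : 0 < 10 - 3 * r := by linarith
  obtain ⟨β, hβr⟩ : ∃ β, β * (10 - 3 * r) = 6 * r - 10 :=
    ⟨(6 * r - 10) / (10 - 3 * r), div_mul_cancel₀ _ hden.ne'⟩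
  have hβ : 0 ≤ β := nonneg_of_mul_nonneg_left (by linarith) hden
  refine ⟨β, hβ, le_of_mul_le_mul_right (by linarith) hden, ?_, ?_⟩
  · have h : 6 + 3 * β ≠ 0 := by positivity
    rw [← sub_eq_iff_eq_add', eq_div_iff h]
    linear_combination -hβr
  · rw [div_eq_div_iff (by positivity) (by linarith)]
    linear_combination -5 * hβr

end Competitiveness

end ListUpdate

theorem mainTheorem6 :
    (∀ β : ℝ, 0 ≤ β →
      ListUpdate.TogCompetitive β (5 / 3 + 5 * β / (6 + 3 * β)) (2 + 2 / (4 + 5 * β))) ∧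
    (∀ r : ℝ, 5 / 3 ≤ r → r ≤ 2 →
      ∃ β : ℝ, 0 ≤ β ∧ β ≤ 1 / 2 ∧ r = 5 / 3 + 5 * β / (6 + 3 * β) ∧
        ListUpdate.TogCompetitive β r (2 + (10 - 3 * r) / (9 * r - 5))) := by
  refine ⟨fun β hβ => ListUpdate.togCompetitive hβ, fun r hr hr₂ => ?_⟩
  obtain ⟨β, hβ, hβ₂, hrβ, hwβ⟩ := ListUpdate.exists_parameter hr hr₂
  have hcompetitive := ListUpdate.togCompetitive hβ
  rw [← hrβ, hwβ] at hcompetitive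
  exact ⟨β, hβ, hβ₂, hrβ, hcompetitive⟩
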